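/- **Setting.** Let $M$ be a compact 3-manifold (not necessarily orientable or connected), given with a triangulation $\mathcal T$: if $\partial M=\emptyset$, $\mathcal T$ is a gluing of finitely many tetrahedra along pairs of faces; if $\partial M\neq\emptyset$, $\mathcal T$ is an ideal triangulation, i.e. a gluing of finitely many truncated tetrahedra along pairs of faces, the truncation triangles forming $\partial M$. Let $E,F,T$ be the sets of edges, faces and tetrahedra of $\mathcal T$ (truncation triangles and their sides are not counted), and $V$ the set of interior vertices ($V=\emptyset$ for an ideal triangulation). Let $b_n(M)=\dim_{\mathbb Z/2}H_n(M;\mathbb Z/2)$. Let $r\ge 3$ and let $A$ be a primitive $4r$-th root of unity, or, for odd $r$, a primitive $2r$-th root of unity. Put $[n]=\frac{A^{2n}-A^{-2n}}{A^2-A^{-2}}$, $[n]!=[n][n-1]\cdots[1]$, $\eta_r=\frac{A^2-A^{-2}}{\sqrt{-2r}}$, $\eta'_r=\frac{A^2-A^{-2}}{\sqrt{-r}}$, $I_r=\{0,1,\dots,r-2\}$ and, for odd $r$, $I'_r=\{i\in I_r: i\text{ even}\}$. A triple $(i,j,k)$ in $I_r$ is admissible if it satisfies the three triangle inequalities, $i+j+k$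 is even and $i+j+k\le 2(r-2)$; a 6-tuple $(i,j,k,l,m,n)$ is admissible if $(i,j,k),(j,l,n),(i,m,n),(k,l,m)$ are. For these put $\bigcirc(i)=(-1)^i[i+1]$, $$\theta(i,j,k)=(-1)^{\frac{i+j+k}2}\frac{[\frac{i+j-k}2]!\,[\frac{j+k-i}2]!\,[\frac{k+i-j}2]!\,[\frac{i+j+k}2+1]!}{[i]!\,[j]!\,[k]!},$$ $$\tau(i,j,k,l,m,n)=\frac{\prod_{a=1}^{4}\prod_{b=1}^{3}[Q_b-T_a]!}{[i]![j]![k]![l]![m]![n]!}\sum_{z=\max_a T_a}^{\min_b Q_b}\frac{(-1)^z[z+1]!}{\prod_{a}[z-T_a]!\prod_{b}[Q_b-z]!},$$ with $T_1=\frac{i+j+k}2$, $T_2=\frac{i+m+n}2$, $T_3=\frac{j+l+n}2$, $T_4=\frac{k+l+m}2$, $Q_1=\frac{i+j+l+m}2$, $Q_2=\frac{i+k+l+n}2$, $Q_3=\frac{j+k+m+n}2$. A coloring $c:E\to I_r$ is admissible if for each tetrahedron $\Delta$, with edges $e_{ab}$ joining its vertices $a,b\in\{1,2,3,4\}$ and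 $c_{ab}=c(e_{ab})$, the 6-tuple $(c_{12},c_{13},c_{23},c_{34},c_{24},c_{14})$ is admissible; let $|\Delta|_c$ be the value of $\tau$ on it, $|e|_c=\bigcirc(c(e))$, and $|f|_c=\theta(c(e_1),c(e_2),c(e_3))$ for a face $f$ with edges $e_1,e_2,e_3$. With $A_r$ (resp. $A'_r$) the set of admissible colorings with values in $I_r$ (resp. $I'_r$), put $$TV_r(M)=\eta_r^{2|V|}\sum_{c\in A_r}\frac{\prod_{e\in E}|e|_c\prod_{\Delta\in T}|\Delta|_c}{\prod_{f\in F}|f|_c},\qquad TV'_r(M)=(\eta'_r)^{2|V|}\sum_{c\in A'_r}\frac{\prod_{e\in E}|e|_c\prod_{\Delta\in T}|\Delta|_c}{\prod_{f\in F}|f|_c}.$$ **Theorem.** For every such $M$ and every such triangulation of $M$: 1. For every odd integer $r\ge3$, $\;TV_r(M)=TV_3(M)\cdot TV'_r(M)$. Here $TV_r(M)$ and $TV'_r(M)$ are taken at the same $A$, and $TV_3(M)$ at any root $A_3$ of the same kind: if $A$ is a primitive $2r$-th root of unity, $A_3$ is any primitive $6$-th root of unity; if $A$ is a primitive $4r$-th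 root of unity, $A_3$ is any primitive $12$-th root of unity. 2. If $\partial M=\emptyset$ and $A=e^{\pi i/3}$, then $TV_3(M)=2^{b_2(M)-b_0(M)}$. 3. If $M$ is connected, $\partial M\ne\emptyset$ and $A=e^{\pi i/3}$, then $TV_3(M)=2^{b_2(M)}$. In particular, $TV_3(M)\neq0$ at $A=e^{\pi i/3}$. -/

import Mathlib

noncomputable section

/-! ## Quantum numbers and the three basic spin networks -/

namespace QuantumNumber

/-- The quantum integer `[n]` at `q = A ^ 2`. -/
def qInt (A : ℂ) (n : ℕ) : ℂ :=
  (A ^ (2 * n) - (A ^ (2 * n))⁻¹) / (A ^ 2 - (A ^ 2)⁻¹)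

/-- The quantum factorial `[n]! = [n] [n-1] ... [1]`. -/
def qFact (A : ℂ) (n : ℕ) : ℂ := ∏ k ∈ Finset.range n, qInt A (k + 1)

/-- A triple of colors is admissible at level `r`. -/
def Admissible (r i j k : ℕ) : Prop :=
  (k ≤ i + j ∧ i ≤ j + k ∧ j ≤ k + i) ∧ Even (i + j + k) ∧ i + j + k ≤ 2 * (r - 2)

/-- A 6-tuple of colors is admissible at level `r`. -/
def Admissible6 (r i j k l m n : ℕ) : Prop :=
  Admissible r i j k ∧ Admissible r j l n ∧ Admissible r i m n ∧ Admissible r k l m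

/-- The value `(-1)^i [i+1]` of the circle colored by `i`. -/
def circle (A : ℂ) (i : ℕ) : ℂ := (-1) ^ i * qInt A (i + 1)

/-- The value of the theta (trihedral) network; used for admissible triples only, for which all
the differences and halves are exact. -/
def theta (A : ℂ) (i j k : ℕ) : ℂ :=
  (-1) ^ ((i + j + k) / 2) *
    (qFact A ((i + j - k) / 2) * qFact A ((j + k - i) / 2) * qFact A ((k + i - j) / 2) *
      qFact A ((i + j + k) / 2 + 1)) /
    (qFact A i * qFact A j * qFact A k)

/-- The half-sums over the four faces. -/
def faceSum (i j k l m n : ℕ) : Fin 4 → ℕ :=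
  ![(i + j + k) / 2, (i + m + n) / 2, (j + l + n) / 2, (k + l + m) / 2]

/-- The half-sums over the three quadrilaterals. -/
def quadSum (i j k l m n : ℕ) : Fin 3 → ℕ :=
  ![(i + j + l + m) / 2, (i + k + l + n) / 2, (j + k + m + n) / 2]

/-- The value of the tetrahedral network; used for admissible 6-tuples only, for which all the
differences and halves are exact. The sum runs over `max T_a ≤ z ≤ min Q_b`. -/
def tetra (A : ℂ) (i j k l m n : ℕ) : ℂ :=
  let S := faceSum i j k l m n
  let Q := quadSum i j k l m n
  (∏ a : Fin 4, ∏ b : Fin 3, qFact A (Q b - S a)) /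
      (qFact A i * qFact A j * qFact A k * qFact A l * qFact A m * qFact A n) *
    ∑ z ∈ Finset.Icc (Finset.univ.sup' Finset.univ_nonempty S)
        (Finset.univ.inf' Finset.univ_nonempty Q),
      (-1) ^ z * qFact A (z + 1) /
        ((∏ a : Fin 4, qFact A (z - S a)) * ∏ b : Fin 3, qFact A (Q b - z))

/-- `η_r = (A² - A⁻²) / √(-2r)`. -/
def eta (r : ℕ) (A : ℂ) : ℂ :=
  (A ^ 2 - (A ^ 2)⁻¹) / (Complex.I * (Real.sqrt (2 * r) : ℂ))

/-- `η'_r = (A² - A⁻²) / √(-r)`. -/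
def etaSO3 (r : ℕ) (A : ℂ) : ℂ :=
  (A ^ 2 - (A ^ 2)⁻¹) / (Complex.I * (Real.sqrt r : ℂ))

/-- The color set `I_r = {0, 1, …, r-2}`. -/
def colors (r : ℕ) : Finset ℕ := Finset.range (r - 1)

/-- The color set `I'_r` of even elements of `I_r`. -/
def colorsSO3 (r : ℕ) : Finset ℕ := (colors r).filter Even

end QuantumNumber

/-! ## Gluings of tetrahedra -/

/-- A gluing of a family `T` of tetrahedra, each with vertices `0, 1, 2, 3`, by affine
homeomorphisms between pairs of distinct faces, every face being glued. The face of `t` opposite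
to the vertex `i` is glued to the face of `adj t i` opposite to `perm t i i`, and the affine
homeomorphism sends the vertex `j ≠ i` of `t` to the vertex `perm t i j` of `adj t i`. -/
structure TetGluing (T : Type*) where
  adj : T → Fin 4 → T
  perm : T → Fin 4 → Equiv.Perm (Fin 4)
  adj_adj : ∀ t i, adj (adj t i) (perm t i i) = t
  perm_adj : ∀ t i, perm (adj t i) (perm t i i) = (perm t i)⁻¹
  ne_self : ∀ t i, ¬ (adj t i = t ∧ perm t i i = i)

namespace TetGluing

/-- Names for the cells of a single tetrahedron and of its truncation. `(none, s)` is the face of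
the tetrahedron spanned by `s` (truncated at its vertices if the tetrahedron is truncated), and
`(some j, s)`, with `j ∈ s`, is the cell in which the truncation triangle at the vertex `j` meets
the face spanned by `s`: a corner of that triangle if `s` is an edge, a side if `s` is a
triangle, and the whole triangle if `s` is everything. -/
abbrev LocalCell := Option (Fin 4) × Finset (Fin 4)

namespace LocalCell

/-- `IsCell ideal x`: `x` is a cell of the tetrahedron (`ideal = false`), respectively of the
truncated tetrahedron (`ideal = true`). -/
def IsCell : Bool → LocalCell → Prop
  | false, x => x.1 = none ∧ x.2.Nonempty
  | true, x => 2 ≤ x.2.card ∧ ∀ j, x.1 = some j → j ∈ x.2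

/-- The dimension of a cell. -/
def dim (x : LocalCell) : ℕ := x.2.card - 1 - (if x.1 = none then 0 else 1)

/-- `y` is a codimension one face of the cell `x`. -/
def IsFacet (ideal : Bool) (y x : LocalCell) : Prop :=
  IsCell ideal y ∧ y.2 ⊆ x.2 ∧ (x.1 = none ∨ y.1 = x.1) ∧ y.dim + 1 = x.dim

/-- Renaming the vertices. -/
def map (σ : Equiv.Perm (Fin 4)) (x : LocalCell) : LocalCell :=
  (x.1.map σ, x.2.map σ.toEmbedding)

lemma map_map_inv (σ : Equiv.Perm (Fin 4)) (x : LocalCell) : (x.map σ).map σ⁻¹ = x := by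
  rcases x with ⟨v, s⟩
  refine Prod.ext ?_ ?_
  · cases v <;> simp [map]
  · ext a; simp [map, Equiv.Perm.inv_def]

lemma map_inv_map (σ : Equiv.Perm (Fin 4)) (x : LocalCell) : (x.map σ⁻¹).map σ = x := by
  simpa using map_map_inv σ⁻¹ x

lemma isCell_map (b : Bool) (σ : Equiv.Perm (Fin 4)) (x : LocalCell) :
    IsCell b (x.map σ) ↔ IsCell b x := by
  rcases x with ⟨v, s⟩
  cases b <;> cases v <;> simp [IsCell, map]

lemma dim_map (σ : Equiv.Perm (Fin 4)) (x : LocalCell) : (x.map σ).dim = x.dim := by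
  rcases x with ⟨v, s⟩
  cases v <;> simp [dim, map]

lemma isFacet_map (b : Bool) (σ : Equiv.Perm (Fin 4)) (y x : LocalCell) :
    IsFacet b (y.map σ) (x.map σ) ↔ IsFacet b y x := by
  have h1 : (y.map σ).2 ⊆ (x.map σ).2 ↔ y.2 ⊆ x.2 := by
    simp [map, Finset.map_subset_map]
  have h2 : (x.map σ).1 = none ↔ x.1 = none := by simp [map]
  have h3 : (y.map σ).1 = (x.map σ).1 ↔ y.1 = x.1 :=
    (Option.map_injective σ.injective).eq_iff
  simp only [IsFacet, isCell_map, dim_map, h1, h2, h3]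

end LocalCell

variable {T : Type*} (X : TetGluing T)

/-- A cell of the tetrahedron `t` that lies in the face opposite to `i` is identified with its
image under the gluing map of that face. -/
def Rel (p p' : T × LocalCell) : Prop :=
  ∃ i, i ∉ p.2.2 ∧ p' = (X.adj p.1 i, p.2.map (X.perm p.1 i))

/-- Cells up to gluing. -/
def Cell := Quot X.Rel

/-- The class of a cell `x` of the tetrahedron `t`. -/
def cell (t : T) (x : LocalCell) : X.Cell := Quot.mk X.Rel (t, x)

/-- The edge joining the vertices `j` and `k` of the tetrahedron `t`, up to gluing. -/
def edgeCell (t : T) (j k : Fin 4) : X.Cell := X.cell t (none, {j, k})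

/-- The set of edges of the gluing. -/
def Edge := {x : X.Cell // ∃ t j k, j ≠ k ∧ x = X.edgeCell t j k}

/-- The edge of the gluing given by the distinct vertices `j` and `k` of `t`. -/
def edge (t : T) (j k : Fin 4) (h : j ≠ k) : X.Edge := ⟨X.edgeCell t j k, t, j, k, h, rfl⟩

/-- The set of vertices of the gluing. -/
def Vertex := {x : X.Cell // ∃ t j, x = X.cell t (none, {j})}

/-- Two faces (each given by a tetrahedron and the opposite vertex) that are glued. -/
def FaceRel (p p' : T × Fin 4) : Prop := p' = (X.adj p.1 p.2, X.perm p.1 p.2 p.2)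

/-- The set of faces (triangles) of the gluing. -/
def Face := Quot X.FaceRel

/-- The `k`-cells of the link of the vertex `j` of `t` up to gluing, a closed connected surface
glued from the truncation triangles. -/
def linkCells (t : T) (j : Fin 4) (k : ℕ) : Set X.Cell :=
  {x | ∃ t' j' s, j' ∈ s ∧ s.card = k + 2 ∧ X.cell t' (none, {j'}) = X.cell t (none, {j}) ∧
    x = X.cell t' (some j', s)}

/-- The Euler characteristic of the link of a vertex. -/
def linkEulerChar (t : T) (j : Fin 4) : ℤ :=
  (X.linkCells t j 0).ncard - (X.linkCells t j 1).ncard + (X.linkCells t j 2).ncard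

end TetGluing

/-! ## Triangulated compact 3-manifolds -/

/-- A triangulated compact 3-manifold, not necessarily orientable or connected, with finite set of
tetrahedra `T`. If `ideal = false` the manifold is the closed 3-manifold obtained by gluing
the tetrahedra; if `ideal = true` it is the compact 3-manifold obtained by gluing the truncated
tetrahedra, whose boundary consists of all the truncation triangles (an ideal triangulation).

No edge may be identified with itself in the reversed direction; the two ends of an edge are
recorded by the corners `(some j, {j, k})` and `(some k, {j, k})`. In the closed case the link of
every vertex, being a closed connected surface, is a sphere if and only if its Euler
characteristic is 2. These conditions say that the glued space is a 3-manifold. -/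
structure TriangulatedThreeManifold (T : Type*) extends TetGluing T where
  ideal : Bool
  edge_not_reversed : ∀ (t : T) (j k : Fin 4), j ≠ k →
    toTetGluing.cell t (some j, {j, k}) ≠ toTetGluing.cell t (some k, {j, k})
  link_sphere : ideal = false → ∀ (t : T) (j : Fin 4), toTetGluing.linkEulerChar t j = 2

namespace TetGluing

variable {T : Type*} [Finite T] (X : TetGluing T)

instance : Finite X.Cell := Finite.of_surjective (Quot.mk X.Rel) Quot.mk_surjective
instance : Finite X.Edge := Subtype.finite
instance : Finite X.Vertex := Subtype.finite
instance : Finite X.Face := Finite.of_surjective (Quot.mk X.FaceRel) Quot.mk_surjective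
instance : Fintype X.Cell := Fintype.ofFinite _
instance : Fintype X.Edge := Fintype.ofFinite _
instance : Fintype X.Face := Fintype.ofFinite _

end TetGluing

namespace TriangulatedThreeManifold

open QuantumNumber TetGluing

variable {T : Type*} (M : TriangulatedThreeManifold T)

/-- The boundary of the manifold is non-empty. -/
def HasBoundary : Prop := M.ideal = true ∧ Nonempty T

/-- The manifold is connected (in particular non-empty). -/
def IsConnected : Prop :=
  Nonempty T ∧ ∀ t t' : T, Relation.ReflTransGen (fun a b => ∃ i, M.adj a i = b) t t'

/-! ### Homology with coefficients in `ℤ/2` -/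

/-- The set of `n`-cells of the manifold: simplices in the closed case, and cells of truncated
tetrahedra in the case of an ideal triangulation, up to gluing. -/
def NCell (n : ℕ) :=
  {x : M.Cell // ∃ t y, LocalCell.IsCell M.ideal y ∧ y.dim = n ∧ x = M.cell t y}

/-- The mod 2 incidence number of the cells `x` and `y`: the number of codimension one faces of
`x` that are glued to `y`. -/
def incidence (x y : M.Cell) : ZMod 2 :=
  Quot.lift
    (fun p : T × LocalCell =>
      (Nat.card {z : LocalCell // LocalCell.IsFacet M.ideal z p.2 ∧ M.cell p.1 z = y} : ZMod 2))
    (by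
      rintro ⟨t, x⟩ p' ⟨i, hi, rfl⟩
      have key : ∀ z : LocalCell, z.2 ⊆ x.2 →
          M.cell t z = M.cell (M.adj t i) (z.map (M.perm t i)) := fun z hz =>
        Quot.sound ⟨i, fun h => hi (hz h), rfl⟩
      refine congrArg _ (Nat.card_congr ?_)
      refine
        { toFun := fun z => ⟨z.1.map (M.perm t i),
            (LocalCell.isFacet_map _ _ _ _).2 z.2.1, (key z.1 z.2.1.2.1) ▸ z.2.2⟩
          invFun := fun z => ⟨z.1.map (M.perm t i)⁻¹, ?_⟩
          left_inv := fun z => Subtype.ext (LocalCell.map_map_inv _ _)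
          right_inv := fun z => Subtype.ext (LocalCell.map_inv_map _ _) }
      have h : LocalCell.IsFacet M.ideal (z.1.map (M.perm t i)⁻¹) x := by
        rw [← LocalCell.isFacet_map _ (M.perm t i), LocalCell.map_inv_map]
        exact z.2.1
      refine ⟨h, ?_⟩
      rw [key _ h.2.1, LocalCell.map_inv_map]
      exact z.2.2)
    x

variable [Fintype T]

instance (n : ℕ) : Finite (M.NCell n) := Subtype.finite
instance (n : ℕ) : Fintype (M.NCell n) := Fintype.ofFinite _

/-- The cellular boundary map `C_{n+1}(M; ℤ/2) → C_n(M; ℤ/2)`. -/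
def boundaryMap (n : ℕ) : (M.NCell (n + 1) → ZMod 2) →ₗ[ZMod 2] (M.NCell n → ZMod 2) :=
  Matrix.mulVecLin (Matrix.of fun y x => M.incidence x.1 y.1)

/-- The space of `n`-cycles. -/
def cycles : (n : ℕ) → Submodule (ZMod 2) (M.NCell n → ZMod 2)
  | 0 => ⊤
  | n + 1 => LinearMap.ker (M.boundaryMap n)

/-- The `n`-th `ℤ/2`-Betti number: the dimension of `H_n(M; ℤ/2)`, cycles modulo boundaries. -/
def betti (n : ℕ) : ℕ :=
  Module.finrank (ZMod 2)
    (M.cycles n ⧸ (LinearMap.range (M.boundaryMap n)).submoduleOf (M.cycles n))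

/-! ### State sums -/


/-- The number of interior vertices; an ideal triangulation has none. -/
def numVertices : ℕ := if M.ideal = true then 0 else Nat.card M.Vertex

/-- A coloring of the edges is admissible if the 6-tuple on each tetrahedron is. -/
def AdmissibleColoring (r : ℕ) (c : M.Edge → ℕ) : Prop :=
  ∀ t : T, Admissible6 r
    (c (M.edge t 0 1 (by decide))) (c (M.edge t 0 2 (by decide))) (c (M.edge t 1 2 (by decide)))
    (c (M.edge t 2 3 (by decide))) (c (M.edge t 1 3 (by decide))) (c (M.edge t 0 3 (by decide)))

open Classical in
/-- The set of admissible colorings at level `r` with colors in the set `I`. -/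
def admissibleColorings (r : ℕ) (I : Finset ℕ) : Finset (M.Edge → ℕ) :=
  (Fintype.piFinset fun _ => I).filter (M.AdmissibleColoring r)

/-- The weight of a face: the theta network of the colors of its three edges. It does not depend
on the tetrahedron that represents the face nor on the order of the edges. -/
def faceWeight (A : ℂ) (c : M.Edge → ℕ) (f : M.Face) : ℂ :=
  let t : T := (Quot.out f).1
  let i : Fin 4 := (Quot.out f).2
  theta A
    (c (M.edge t (i.succAbove 0) (i.succAbove 1) (i.succAbove_right_injective.ne (by decide))))
    (c (M.edge t (i.succAbove 0) (i.succAbove 2) (i.succAbove_right_injective.ne (by decide))))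
    (c (M.edge t (i.succAbove 1) (i.succAbove 2) (i.succAbove_right_injective.ne (by decide))))

/-- The weight of a tetrahedron. -/
def tetWeight (A : ℂ) (c : M.Edge → ℕ) (t : T) : ℂ :=
  tetra A
    (c (M.edge t 0 1 (by decide))) (c (M.edge t 0 2 (by decide))) (c (M.edge t 1 2 (by decide)))
    (c (M.edge t 2 3 (by decide))) (c (M.edge t 1 3 (by decide))) (c (M.edge t 0 3 (by decide)))

/-- The sum over the admissible colorings with colors in `I` of the product of the weights. -/
def stateSum (r : ℕ) (A : ℂ) (I : Finset ℕ) : ℂ :=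
  ∑ c ∈ M.admissibleColorings r I,
    ((∏ e : M.Edge, circle A (c e)) * ∏ t : T, M.tetWeight A c t) /
      ∏ f : M.Face, M.faceWeight A c f

/-- The Turaev-Viro invariant `TV_r(M)` at the root of unity `A`. -/
def turaevViro (r : ℕ) (A : ℂ) : ℂ :=
  eta r A ^ (2 * M.numVertices) * M.stateSum r A (colors r)

/-- The `SO(3)` Turaev-Viro invariant `TV'_r(M)` at the root of unity `A`. -/
def turaevViroSO3 (r : ℕ) (A : ℂ) : ℂ :=
  etaSO3 r A ^ (2 * M.numVertices) * M.stateSum r A (colorsSO3 r)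

end TriangulatedThreeManifold

end

noncomputable section

namespace QuantumNumber

/-- The features of a root of unity of level `r` on which the reduction to even colors depends:
the sign `s` relates `[r - n]` to `[n]`. -/
structure IsReflecting (r : ℕ) (A s : ℂ) : Prop where
  sq : s * s = 1
  refl : ∀ n ≤ r, qInt A (r - n) = s * qInt A n
  ne_zero : ∀ n, 0 < n → n < r → qInt A n ≠ 0

lemma qFact_zero (A : ℂ) : qFact A 0 = 1 := by simp [qFact]

lemma qFact_succ (A : ℂ) (n : ℕ) : qFact A (n + 1) = qFact A n * qInt A (n + 1) := by
  simp [qFact, Finset.prod_range_succ]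

namespace IsReflecting

variable {r : ℕ} {A s : ℂ} (h : IsReflecting r A s)
include h

lemma sign_ne_zero : s ≠ 0 := left_ne_zero_of_mul_eq_one h.sq

lemma qInt_self : qInt A r = 0 := by
  have := h.refl r le_rfl
  have h0 : qInt A 0 = 0 := by simp [qInt]
  rw [Nat.sub_self, h0] at this
  exact (mul_eq_zero.1 this.symm).resolve_left h.sign_ne_zero

lemma qFact_ne_zero {n : ℕ} (hn : n < r) : qFact A n ≠ 0 :=
  Finset.prod_ne_zero_iff.2 fun k hk =>
    h.ne_zero _ k.succ_pos (by have := Finset.mem_range.1 hk; omega)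

lemma qFact_eq_zero (hr : 0 < r) {n : ℕ} (hn : r ≤ n) : qFact A n = 0 :=
  Finset.prod_eq_zero (i := r - 1) (Finset.mem_range.2 (by omega))
    (by rw [Nat.sub_add_cancel hr]; exact h.qInt_self)

lemma qFact_mul_qFact {n : ℕ} (hn : n < r) :
    qFact A n * qFact A (r - 1 - n) = s ^ n * qFact A (r - 1) := by
  induction n with
  | zero => simp [qFact_zero]
  | succ n ih =>
    have h1 := ih (by omega)
    have h2 : r - 1 - n = (r - 1 - (n + 1)) + 1 := by omega
    have h3 : r - 1 - (n + 1) + 1 = r - (n + 1) := by omega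
    rw [h2, qFact_succ, h3, h.refl _ hn.le] at h1
    rw [qFact_succ, pow_succ]
    linear_combination s * h1 - qFact A n * qInt A (n + 1) * qFact A (r - 1 - (n + 1)) * h.sq

end IsReflecting

/-- The inverse of the quantum factorial, extended by zero to the negative integers. -/
def invFact (A : ℂ) (n : ℤ) : ℂ := if n < 0 then 0 else (qFact A n.toNat)⁻¹

/-- The quantum factorial, extended by zero to the negative integers. -/
def extFact (A : ℂ) (n : ℤ) : ℂ := if n < 0 then 0 else qFact A n.toNat

lemma invFact_natCast (A : ℂ) (n : ℕ) : invFact A n = (qFact A n)⁻¹ := by simp [invFact]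

lemma invFact_of_neg (A : ℂ) {n : ℤ} (hn : n < 0) : invFact A n = 0 := by simp [invFact, hn]

lemma IsReflecting.extFact_eq {r : ℕ} {A s : ℂ} (h : IsReflecting r A s) (hr : 0 < r) (n : ℤ) :
    extFact A n = qFact A (r - 1) * s ^ n * invFact A (r - 1 - n) := by
  rcases lt_or_ge n 0 with hn | hn
  · have h1 : ¬ ((r : ℤ) - 1 - n < 0) := by omega
    have h2 : r ≤ ((r : ℤ) - 1 - n).toNat := by omega
    simp [extFact, invFact, hn, h1, h.qFact_eq_zero hr h2]
  · lift n to ℕ using hn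
    rcases lt_or_ge n r with hnr | hnr
    · have h1 : ((r : ℤ) - 1 - n) = ((r - 1 - n : ℕ) : ℤ) := by omega
      have h2 := h.qFact_mul_qFact hnr
      have h3 : qFact A (r - 1 - n) ≠ 0 := h.qFact_ne_zero (by omega)
      rw [h1, invFact_natCast]
      simp only [extFact, Int.natCast_nonneg, not_lt.2, if_false, Int.toNat_natCast, zpow_natCast]
      field_simp
      linear_combination h2
    · have h1 : ((r : ℤ) - 1 - n < 0) := by omega
      simp [extFact, invFact, h1, h.qFact_eq_zero hr hnr]

/-- The sum over `z` in the definition of the tetrahedral network. -/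
def racahSum (A : ℂ) (S : Fin 4 → ℕ) (Q : Fin 3 → ℕ) : ℂ :=
  ∑ z ∈ Finset.Icc (Finset.univ.sup' Finset.univ_nonempty S)
        (Finset.univ.inf' Finset.univ_nonempty Q),
      (-1) ^ z * qFact A (z + 1) /
        ((∏ a : Fin 4, qFact A (z - S a)) * ∏ b : Fin 3, qFact A (Q b - z))

lemma racahSum_eq_finsum (A : ℂ) (S : Fin 4 → ℕ) (Q : Fin 3 → ℕ) :
    racahSum A S Q = ∑ᶠ z : ℤ, (-1) ^ z * extFact A (z + 1) *
      ((∏ a, invFact A (z - S a)) * ∏ b, invFact A (Q b - z)) := by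
  rw [finsum_eq_sum_of_support_subset (s := (Finset.Icc
    (Finset.univ.sup' Finset.univ_nonempty S)
      (Finset.univ.inf' Finset.univ_nonempty Q)).map Nat.castEmbedding)]
  · rw [Finset.sum_map, racahSum]
    refine Finset.sum_congr rfl fun z hz => ?_
    rw [Finset.mem_Icc, Finset.sup'_le_iff, Finset.le_inf'_iff] at hz
    have h1 : ∀ a, invFact A ((z : ℤ) - S a) = (qFact A (z - S a))⁻¹ := fun a => by
      rw [← invFact_natCast, Nat.cast_sub (hz.1 a (Finset.mem_univ _))]
    have h2 : ∀ b, invFact A ((Q b : ℤ) - z) = (qFact A (Q b - z))⁻¹ := fun b => by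
      rw [← invFact_natCast, Nat.cast_sub (hz.2 b (Finset.mem_univ _))]
    have h3 : extFact A ((z : ℤ) + 1) = qFact A (z + 1) := by
      rw [extFact, if_neg (by omega)]; congr 1
    simp only [Nat.castEmbedding_apply, h1, h2, h3, zpow_natCast, Finset.prod_inv_distrib,
      div_eq_mul_inv, mul_inv]
  · intro z hz
    simp only [Function.mem_support, mul_ne_zero_iff] at hz
    have h1 : ∀ a, (S a : ℤ) ≤ z := fun a => by
      by_contra! hlt
      exact hz.2.1 (Finset.prod_eq_zero (Finset.mem_univ a) (invFact_of_neg A (by omega)))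
    have h2 : ∀ b, z ≤ (Q b : ℤ) := fun b => by
      by_contra! hlt
      exact hz.2.2 (Finset.prod_eq_zero (Finset.mem_univ b) (invFact_of_neg A (by omega)))
    have h3 : 0 ≤ z := (Int.natCast_nonneg _).trans (h1 0)
    lift z to ℕ using h3
    rw [Finset.coe_map]
    refine ⟨z, ?_, rfl⟩
    rw [Finset.mem_coe, Finset.mem_Icc, Finset.sup'_le_iff, Finset.le_inf'_iff]
    exact ⟨fun a _ => by exact_mod_cast h1 a, fun b _ => by exact_mod_cast h2 b⟩

/-- A form of the sum in the tetrahedral network in which the bounds `r - 2` and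
`min Q_b` play the same role. -/
def symRacah (A ε : ℂ) (S Q : Fin 4 → ℤ) : ℂ :=
  ∑ᶠ z : ℤ, ε ^ z * ((∏ a, invFact A (z - S a)) * ∏ b, invFact A (Q b - z))

lemma IsReflecting.racahSum_eq {r : ℕ} {A s : ℂ} (h : IsReflecting r A s) (hr : 0 < r)
    (S : Fin 4 → ℕ) (Q : Fin 3 → ℕ) :
    racahSum A S Q = qFact A (r - 1) * s *
      symRacah A (-s) (fun a => S a) ![(Q 0 : ℤ), Q 1, Q 2, r - 2] := by
  rw [racahSum_eq_finsum, symRacah, mul_finsum]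
  refine finsum_congr fun z => ?_
  have h1 : (r : ℤ) - 1 - (z + 1) = r - 2 - z := by ring
  rw [h.extFact_eq hr, h1, zpow_add₀ h.sign_ne_zero, zpow_one, neg_eq_neg_one_mul s, mul_zpow]
  simp only [Fin.prod_univ_four, Fin.prod_univ_three, Matrix.cons_val_zero, Matrix.cons_val_one,
    Matrix.cons_val]
  ring

lemma symRacah_reflect {A ε : ℂ} (hε : ε * ε = 1) {S Q S' Q' : Fin 4 → ℤ} (N : ℤ)
    (σ τ : Equiv.Perm (Fin 4)) (hS : ∀ a, S' a = N - Q (σ a)) (hQ : ∀ b, Q' b = N - S (τ b)) :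
    symRacah A ε S' Q' = ε ^ N * symRacah A ε S Q := by
  rw [symRacah, ← finsum_comp_equiv (Equiv.subLeft N), symRacah, mul_finsum]
  refine finsum_congr fun z => ?_
  have h0 : ε ≠ 0 := left_ne_zero_of_mul_eq_one hε
  have h1 : ε ^ (N - z) = ε ^ N * ε ^ z := by
    rw [zpow_sub₀ h0, div_eq_mul_inv, ← inv_zpow, inv_eq_of_mul_eq_one_left hε]
  have h2 : ∀ a, N - z - S' a = Q (σ a) - z := fun a => by rw [hS]; ring
  have h3 : ∀ b, Q' b - (N - z) = z - S (τ b) := fun b => by rw [hQ]; ring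
  simp only [Equiv.subLeft_apply, h1, h2, h3]
  rw [Equiv.prod_comp σ fun a => invFact A (Q a - z),
    Equiv.prod_comp τ fun a => invFact A (z - S a)]
  ring

lemma symRacah_shift {A ε : ℂ} (hε : ε ≠ 0) {S Q S' Q' : Fin 4 → ℤ} (N : ℤ)
    (σ τ : Equiv.Perm (Fin 4)) (hS : ∀ a, S' a = S (σ a) + N) (hQ : ∀ b, Q' b = Q (τ b) + N) :
    symRacah A ε S' Q' = ε ^ N * symRacah A ε S Q := by
  rw [symRacah, ← finsum_comp_equiv (Equiv.addRight N), symRacah, mul_finsum]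
  refine finsum_congr fun z => ?_
  have h2 : ∀ a, z + N - S' a = z - S (σ a) := fun a => by rw [hS]; ring
  have h3 : ∀ b, Q' b - (z + N) = Q (τ b) - z := fun b => by rw [hQ]; ring
  simp only [Equiv.coe_addRight, zpow_add₀ hε, h2, h3]
  rw [Equiv.prod_comp σ fun a => invFact A (z - S a),
    Equiv.prod_comp τ fun a => invFact A (Q a - z)]
  ring

/-- Replace the color `c` by `r - 2 - c` if `a ≠ 0`. -/
def recolor (r a c : ℕ) : ℕ := if a = 0 then c else r - 2 - c

lemma recolor_zero (r c : ℕ) : recolor r 0 c = c := rfl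

lemma recolor_one (r c : ℕ) : recolor r 1 c = r - 2 - c := rfl

lemma zpow_eq_pow_of_even_sub {ε : ℂ} (hε : ε * ε = 1) {m : ℤ} {n : ℕ} (h : Even (m - n)) :
    ε ^ m = ε ^ n := by
  obtain ⟨k, hk⟩ := h
  have h0 : ε ≠ 0 := left_ne_zero_of_mul_eq_one hε
  rw [show m = n + (k + k) by omega, zpow_add₀ h0, zpow_natCast, zpow_add₀ h0, ← mul_zpow, hε,
    one_zpow, mul_one]

lemma IsReflecting.racahSum_recolor {r : ℕ} {A s : ℂ} (h : IsReflecting r A s) {ρ : ℕ}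
    (hr : r = 2 * ρ + 3) {a b c d e f : ℕ} (hd : d ≤ 1) (he : e ≤ 1) (hf : f ≤ 1)
    (ha' : a ≤ 1) (hb' : b ≤ 1) (hc' : c ≤ 1)
    (ha : Even (a + e + f)) (hb : Even (b + d + f)) (hc : Even (c + d + e))
    {i j k l m n : ℕ} (hi : i ≤ ρ) (hj : j ≤ ρ) (hk : k ≤ ρ) (hl : l ≤ ρ) (hm : m ≤ ρ)
    (hn : n ≤ ρ) :
    racahSum A
        (faceSum (recolor r a (2 * i)) (recolor r b (2 * j)) (recolor r c (2 * k))
          (recolor r d (2 * l)) (recolor r e (2 * m)) (recolor r f (2 * n)))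
        (quadSum (recolor r a (2 * i)) (recolor r b (2 * j)) (recolor r c (2 * k))
          (recolor r d (2 * l)) (recolor r e (2 * m)) (recolor r f (2 * n))) =
      (-s) ^ ((if a + b + c + d + e + f = 0 then 0 else 1) +
          (i * d + j * e + k * f + l * a + m * b + n * c)) *
        racahSum A (faceSum (2 * i) (2 * j) (2 * k) (2 * l) (2 * m) (2 * n))
          (quadSum (2 * i) (2 * j) (2 * k) (2 * l) (2 * m) (2 * n)) := by
  subst hr
  have hs : (-s) * (-s) = 1 := by rw [neg_mul_neg, h.sq]
  have hs0 : -s ≠ 0 := left_ne_zero_of_mul_eq_one hs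
  rw [h.racahSum_eq (by omega), h.racahSum_eq (by omega), mul_left_comm]
  congr 1
  obtain ⟨a', ha⟩ := ha
  obtain ⟨b', hb⟩ := hb
  obtain ⟨c', hc⟩ := hc
  have key : ∀ N : ℤ, Even (N - ((if a + b + c + d + e + f = 0 then 0 else 1) +
          (i * d + j * e + k * f + l * a + m * b + n * c) : ℕ)) → (-s) ^ N =
          (-s) ^ ((if a + b + c + d + e + f = 0 then 0 else 1) +
          (i * d + j * e + k * f + l * a + m * b + n * c)) := fun N hN =>
    zpow_eq_pow_of_even_sub hs hN
  rcases Nat.le_one_iff_eq_zero_or_eq_one.1 hd with rfl | rfl <;>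
  rcases Nat.le_one_iff_eq_zero_or_eq_one.1 he with rfl | rfl <;>
  rcases Nat.le_one_iff_eq_zero_or_eq_one.1 hf with rfl | rfl
  · obtain rfl : a = 0 := by omega
    obtain rfl : b = 0 := by omega
    obtain rfl : c = 0 := by omega
    simp [recolor_zero]
  · obtain rfl : a = 1 := by omega
    obtain rfl : b = 1 := by omega
    obtain rfl : c = 0 := by omega
    rw [← key (2 * ρ + 1 + ((k + l + m) : ℤ)) (by rw [Int.even_iff]; push_cast; omega)]
    refine symRacah_reflect hs _ 1 1 ?_ ?_ <;>
      (simp +decide [Fin.forall_fin_succ, faceSum, quadSum, recolor_zero, recolor_one]; omega)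
  · obtain rfl : a = 1 := by omega
    obtain rfl : b = 0 := by omega
    obtain rfl : c = 1 := by omega
    rw [← key (2 * ρ + 1 + ((j + l + n) : ℤ)) (by rw [Int.even_iff]; push_cast; omega)]
    refine symRacah_reflect hs _ 
      (Function.Involutive.toPerm ![1, 0, 3, 2] (by unfold Function.Involutive; decide))
      (Function.Involutive.toPerm ![1, 0, 3, 2] (by unfold Function.Involutive; decide)) ?_ ?_ <;>
      (simp +decide [Fin.forall_fin_succ, faceSum, quadSum, recolor_zero, recolor_one]; omega)
  · obtain rfl : a = 0 := by omega
    obtain rfl : b = 1 := by omega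
    obtain rfl : c = 1 := by omega
    rw [← key (2 * ρ + 1 + (-(j + k + m + n) : ℤ)) (by rw [Int.even_iff]; push_cast; omega)]
    refine symRacah_shift hs0 _ 
      (Function.Involutive.toPerm ![1, 0, 3, 2] (by unfold Function.Involutive; decide))
      (Function.Involutive.toPerm ![1, 0, 3, 2] (by unfold Function.Involutive; decide)) ?_ ?_ <;>
      (simp +decide [Fin.forall_fin_succ, faceSum, quadSum, recolor_zero, recolor_one]; omega)
  · obtain rfl : a = 0 := by omega
    obtain rfl : b = 1 := by omega
    obtain rfl : c = 1 := by omega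
    rw [← key (2 * ρ + 1 + ((i + m + n) : ℤ)) (by rw [Int.even_iff]; push_cast; omega)]
    refine symRacah_reflect hs _ 
      (Function.Involutive.toPerm ![2, 3, 0, 1] (by unfold Function.Involutive; decide))
      (Function.Involutive.toPerm ![2, 3, 0, 1] (by unfold Function.Involutive; decide)) ?_ ?_ <;>
      (simp +decide [Fin.forall_fin_succ, faceSum, quadSum, recolor_zero, recolor_one]; omega)
  · obtain rfl : a = 1 := by omega
    obtain rfl : b = 0 := by omega
    obtain rfl : c = 1 := by omega
    rw [← key (2 * ρ + 1 + (-(i + k + l + n) : ℤ)) (by rw [Int.even_iff]; push_cast; omega)]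
    refine symRacah_shift hs0 _ 
      (Function.Involutive.toPerm ![2, 3, 0, 1] (by unfold Function.Involutive; decide))
      (Function.Involutive.toPerm ![2, 3, 0, 1] (by unfold Function.Involutive; decide)) ?_ ?_ <;>
      (simp +decide [Fin.forall_fin_succ, faceSum, quadSum, recolor_zero, recolor_one]; omega)
  · obtain rfl : a = 1 := by omega
    obtain rfl : b = 1 := by omega
    obtain rfl : c = 0 := by omega
    rw [← key (2 * ρ + 1 + (-(i + j + l + m) : ℤ)) (by rw [Int.even_iff]; push_cast; omega)]
    refine symRacah_shift hs0 _ 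
      (Function.Involutive.toPerm ![3, 2, 1, 0] (by unfold Function.Involutive; decide))
      (Function.Involutive.toPerm ![3, 2, 1, 0] (by unfold Function.Involutive; decide)) ?_ ?_ <;>
      (simp +decide [Fin.forall_fin_succ, faceSum, quadSum, recolor_zero, recolor_one]; omega)
  · obtain rfl : a = 0 := by omega
    obtain rfl : b = 0 := by omega
    obtain rfl : c = 0 := by omega
    rw [← key (2 * ρ + 1 + ((i + j + k) : ℤ)) (by rw [Int.even_iff]; push_cast; omega)]
    refine symRacah_reflect hs _ 
      (Function.Involutive.toPerm ![3, 2, 1, 0] (by unfold Function.Involutive; decide))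
      (Function.Involutive.toPerm ![3, 2, 1, 0] (by unfold Function.Involutive; decide)) ?_ ?_ <;>
      (simp +decide [Fin.forall_fin_succ, faceSum, quadSum, recolor_zero, recolor_one]; omega)

end QuantumNumber

namespace QuantumNumber

/-- The product of the three factorials attached to the corners of a triangle. -/
def cornerFact (A : ℂ) (i j k : ℕ) : ℂ :=
  qFact A ((i + j - k) / 2) * qFact A ((j + k - i) / 2) * qFact A ((k + i - j) / 2)

/-- The contribution of a face to the state sum, once the factorials of the colors of the edges
are cancelled. -/
def faceFactor (A : ℂ) (i j k : ℕ) : ℂ :=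
  (-1) ^ ((i + j + k) / 2) * cornerFact A i j k / qFact A ((i + j + k) / 2 + 1)

lemma cornerFact_swap_left (A : ℂ) (i j k : ℕ) : cornerFact A j i k = cornerFact A i j k := by
  rw [cornerFact, cornerFact, add_comm j i, add_comm i k, add_comm k j]; ring

lemma cornerFact_swap_right (A : ℂ) (i j k : ℕ) : cornerFact A i k j = cornerFact A i j k := by
  rw [cornerFact, cornerFact, add_comm k j, add_comm i k, add_comm j i]; ring

lemma theta_eq (A : ℂ) (i j k : ℕ) :
    theta A i j k = (-1) ^ ((i + j + k) / 2) * (cornerFact A i j k *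
      qFact A ((i + j + k) / 2 + 1)) / (qFact A i * qFact A j * qFact A k) := rfl

lemma tetra_eq (A : ℂ) {r i j k l m n : ℕ} (h : Admissible6 r i j k l m n) :
    tetra A i j k l m n =
      (cornerFact A i j k * cornerFact A i m n * cornerFact A j l n * cornerFact A k l m) /
      (qFact A i * qFact A j * qFact A k * qFact A l * qFact A m * qFact A n) *
        racahSum A (faceSum i j k l m n) (quadSum i j k l m n) := by
  unfold tetra racahSum
  obtain ⟨⟨_, ⟨a, ha⟩, _⟩, ⟨_, ⟨b, hb⟩, _⟩, ⟨_, ⟨c, hc⟩, _⟩, ⟨_, ⟨d, hd⟩, _⟩⟩ := h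
  simp only [Fin.prod_univ_four, Fin.prod_univ_three, faceSum, quadSum, cornerFact,
    Matrix.cons_val_zero, Matrix.cons_val_one, Matrix.cons_val]
  rw [show (i + j + l + m) / 2 - (i + j + k) / 2 = (l + m - k) / 2 by omega,
    show (i + k + l + n) / 2 - (i + j + k) / 2 = (l + n - j) / 2 by omega,
    show (j + k + m + n) / 2 - (i + j + k) / 2 = (m + n - i) / 2 by omega,
    show (i + j + l + m) / 2 - (i + m + n) / 2 = (j + l - n) / 2 by omega,
    show (i + k + l + n) / 2 - (i + m + n) / 2 = (k + l - m) / 2 by omega,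
    show (j + k + m + n) / 2 - (i + m + n) / 2 = (j + k - i) / 2 by omega,
    show (i + j + l + m) / 2 - (j + l + n) / 2 = (i + m - n) / 2 by omega,
    show (i + k + l + n) / 2 - (j + l + n) / 2 = (k + i - j) / 2 by omega,
    show (j + k + m + n) / 2 - (j + l + n) / 2 = (m + k - l) / 2 by omega,
    show (i + j + l + m) / 2 - (k + l + m) / 2 = (i + j - k) / 2 by omega,
    show (i + k + l + n) / 2 - (k + l + m) / 2 = (n + i - m) / 2 by omega,
    show (j + k + m + n) / 2 - (k + l + m) / 2 = (n + j - l) / 2 by omega]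
  ring

lemma neg_one_pow_eq_neg {m n : ℕ} (h : Even m ↔ ¬ Even n) : (-1 : ℂ) ^ m = -(-1) ^ n := by
  by_cases hn : Even n
  · rw [hn.neg_one_pow, (Nat.not_even_iff_odd.1 fun hm => h.1 hm hn).neg_one_pow]
  · rw [(h.2 hn).neg_one_pow, (Nat.not_even_iff_odd.1 hn).neg_one_pow, neg_neg]

namespace IsReflecting

variable {r : ℕ} {A s : ℂ} (h : IsReflecting r A s)
include h

lemma cornerFact_ne_zero {i j k : ℕ} (hr : 2 ≤ r) (ha : Admissible r i j k) :
    cornerFact A i j k ≠ 0 := by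
  obtain ⟨h1, h2, h3⟩ := ha
  exact mul_ne_zero (mul_ne_zero (h.qFact_ne_zero (by omega)) (h.qFact_ne_zero (by omega)))
    (h.qFact_ne_zero (by omega))

lemma circle_recolor (hr : Odd r) {a c : ℕ} (ha : a ≤ 1) (hc : c + 2 ≤ r) :
    circle A (recolor r a c) = (-s) ^ a * circle A c := by
  rcases Nat.le_one_iff_eq_zero_or_eq_one.1 ha with rfl | rfl
  · simp [recolor_zero]
  · have h1 := h.refl (c + 1) (by omega)
    have h2 : r - 2 - c + 1 = r - (c + 1) := by omega
    have h3 : (-1 : ℂ) ^ (r - 2 - c) = -(-1) ^ c := by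
      refine neg_one_pow_eq_neg ?_
      rw [Nat.odd_iff] at hr
      simp only [Nat.even_iff]
      omega
    rw [recolor_one, circle, circle, h2, h1, h3]
    ring

lemma faceFactor_recolor_aux {ρ : ℕ} (hr : r = 2 * ρ + 3) {i j k : ℕ}
    (ha : Admissible r (2 * i) (2 * j) (2 * k)) :
    faceFactor A (r - 2 - 2 * i) (r - 2 - 2 * j) (2 * k) =
      (-s) * faceFactor A (2 * i) (2 * j) (2 * k) := by
  obtain ⟨h1, -, h3⟩ := ha
  have hS := h.qFact_mul_qFact (n := i + j + k + 1) (by omega)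
  have hm := h.qFact_mul_qFact (n := i + j - k) (by omega)
  have hS0 := h.qFact_ne_zero (n := i + j + k + 1) (by omega)
  have hS1 := h.qFact_ne_zero (n := r - 1 - (i + j - k)) (by omega)
  have e1 : (-1 : ℂ) ^ (r - 2 - (i + j - k)) = -(-1) ^ (i + j + k) := by
    refine neg_one_pow_eq_neg ?_
    simp only [Nat.even_iff]
    omega
  have e2 : s ^ (i + j + k + 1) = s * s ^ (i + j - k) := by
    rw [show i + j + k + 1 = 1 + (i + j - k) + 2 * k by omega, pow_add, pow_mul, pow_two, h.sq]
    ring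
  simp only [faceFactor, cornerFact]
  rw [show (2 * i + 2 * j + 2 * k) / 2 = i + j + k by omega,
    show (2 * i + 2 * j - 2 * k) / 2 = i + j - k by omega,
    show (r - 2 - 2 * i + (r - 2 - 2 * j) + 2 * k) / 2 = r - 2 - (i + j - k) by omega,
    show (r - 2 - 2 * i + (r - 2 - 2 * j) - 2 * k) / 2 = r - 1 - (i + j + k + 1) by omega,
    show (r - 2 - 2 * j + 2 * k - (r - 2 - 2 * i)) / 2 = (2 * k + 2 * i - 2 * j) / 2 by omega,
    show (2 * k + (r - 2 - 2 * i) - (r - 2 - 2 * j)) / 2 = (2 * j + 2 * k - 2 * i) / 2 by omega,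
    show r - 2 - (i + j - k) + 1 = r - 1 - (i + j - k) by omega, e1]
  have key : qFact A (r - 1 - (i + j + k + 1)) * qFact A (i + j + k + 1) =
      s * (qFact A (i + j - k) * qFact A (r - 1 - (i + j - k))) := by
    rw [mul_comm, hS, hm, e2, mul_assoc]
  rw [mul_div_assoc', div_eq_div_iff hS1 hS0]
  linear_combination -(-1) ^ (i + j + k) * qFact A ((2 * k + 2 * i - 2 * j) / 2) *
    qFact A ((2 * j + 2 * k - 2 * i) / 2) * key

lemma faceFactor_recolor {ρ : ℕ} (hr : r = 2 * ρ + 3) {a b c i j k : ℕ} (ha1 : a ≤ 1)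
    (hb1 : b ≤ 1) (hc1 : c ≤ 1) (habc : Even (a + b + c))
    (ha : Admissible r (2 * i) (2 * j) (2 * k)) :
    faceFactor A (recolor r a (2 * i)) (recolor r b (2 * j)) (recolor r c (2 * k)) =
      (-s) ^ ((a + b + c) / 2) * faceFactor A (2 * i) (2 * j) (2 * k) := by
  have hl : ∀ x y z, faceFactor A y x z = faceFactor A x y z := fun x y z => by
    rw [faceFactor, faceFactor, cornerFact_swap_left, add_comm y x]
  have hr' : ∀ x y z, faceFactor A x z y = faceFactor A x y z := fun x y z => by
    rw [faceFactor, faceFactor, cornerFact_swap_right, add_right_comm]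
  obtain ⟨t, ht⟩ := habc
  rcases Nat.le_one_iff_eq_zero_or_eq_one.1 ha1 with rfl | rfl <;>
  rcases Nat.le_one_iff_eq_zero_or_eq_one.1 hb1 with rfl | rfl
  · obtain rfl : c = 0 := by omega
    simp [recolor_zero]
  · obtain rfl : c = 1 := by omega
    rw [recolor_zero, recolor_one, recolor_one, ← hl, ← hr',
      h.faceFactor_recolor_aux hr (by
        obtain ⟨h1, -, h3⟩ := ha
        exact ⟨by omega, ⟨i + j + k, by omega⟩, by omega⟩), hr', hl]
    simp
  · obtain rfl : c = 1 := by omega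
    rw [recolor_zero, recolor_one, recolor_one, ← hr',
      h.faceFactor_recolor_aux hr (by
        obtain ⟨h1, -, h3⟩ := ha
        exact ⟨by omega, ⟨i + j + k, by omega⟩, by omega⟩), hr']
    simp
  · obtain rfl : c = 0 := by omega
    rw [recolor_zero, recolor_one, recolor_one, h.faceFactor_recolor_aux hr ha]
    simp

end IsReflecting

/-- A triple of recolored even colors is admissible if and only if the even colors are admissible
and the recoloring is admissible at level `3`. -/
lemma admissible_recolor {ρ r : ℕ} (hr : r = 2 * ρ + 3) {a b c i j k : ℕ} (ha : a ≤ 1)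
    (hb : b ≤ 1) (hc : c ≤ 1) (hi : i ≤ ρ) (hj : j ≤ ρ) (hk : k ≤ ρ) :
    Admissible r (recolor r a (2 * i)) (recolor r b (2 * j)) (recolor r c (2 * k)) ↔
      Admissible 3 a b c ∧ Admissible r (2 * i) (2 * j) (2 * k) := by
  subst hr
  simp only [Admissible, Nat.even_iff]
  rcases Nat.le_one_iff_eq_zero_or_eq_one.1 ha with rfl | rfl <;>
  rcases Nat.le_one_iff_eq_zero_or_eq_one.1 hb with rfl | rfl <;>
  rcases Nat.le_one_iff_eq_zero_or_eq_one.1 hc with rfl | rfl <;>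
  simp only [recolor_zero, recolor_one] <;>
  refine ⟨fun ⟨h1, h2, h3⟩ => ⟨⟨?_, ?_, ?_⟩, ?_, ?_, ?_⟩,
    fun ⟨⟨h1, h2, h3⟩, h4, h5, h6⟩ => ⟨?_, ?_, ?_⟩⟩ <;>
  first | trivial | omega

lemma isReflecting_of_pow {r : ℕ} {A ε : ℂ} (hA : A ≠ 0) (hε : ε * ε = 1)
    (hr : A ^ (2 * r) = ε) (hne : ∀ n, 0 < n → n < r → A ^ (4 * n) ≠ 1) (h1 : 1 < r) :
    IsReflecting r A (-ε) := by
  have hne' : ∀ n, 0 < n → n < r → A ^ (2 * n) - (A ^ (2 * n))⁻¹ ≠ 0 := fun n h0 hn hz => by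
    have h2 : A ^ (2 * n) ≠ 0 := pow_ne_zero _ hA
    refine hne n h0 hn ?_
    rw [show 4 * n = 2 * n + 2 * n by ring, pow_add]
    rw [sub_eq_zero] at hz
    nth_rewrite 1 [hz]
    exact inv_mul_cancel₀ h2
  refine ⟨by rw [neg_mul_neg, hε], fun n hn => ?_, fun n h0 hn => ?_⟩
  · have h2 : A ^ (2 * n) ≠ 0 := pow_ne_zero _ hA
    have h3 : A ^ (2 * (r - n)) = ε * (A ^ (2 * n))⁻¹ := by
      rw [eq_mul_inv_iff_mul_eq₀ h2, ← pow_add, ← hr]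
      congr 1
      omega
    rw [qInt, qInt, h3, mul_inv, inv_inv, inv_eq_of_mul_eq_one_left hε]
    ring
  · exact div_ne_zero (hne' n h0 hn) (by simpa using hne' 1 one_pos h1)

lemma isReflecting_two_mul {r : ℕ} {A : ℂ} (hr : Odd r) (h1 : 1 < r)
    (hA : IsPrimitiveRoot A (2 * r)) : IsReflecting r A (-1) := by
  refine isReflecting_of_pow (hA.ne_zero (by omega)) (one_mul 1) hA.pow_eq_one (fun n h0 hn h => ?_) h1
  have h2 := (hA.pow_eq_one_iff_dvd (4 * n)).1 h
  rw [show 4 * n = 2 * (2 * n) by ring] at h2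
  have h3 := (Nat.Coprime.dvd_mul_left (Nat.coprime_two_right.2 hr)).1
    (Nat.dvd_of_mul_dvd_mul_left two_pos h2)
  exact absurd (Nat.le_of_dvd h0 h3) (by omega)

lemma isReflecting_four_mul {r : ℕ} {A : ℂ} (h1 : 1 < r)
    (hA : IsPrimitiveRoot A (4 * r)) : IsReflecting r A 1 := by
  have hε : A ^ (2 * r) = -1 := by
    have h2 : (A ^ (2 * r)) ^ 2 = 1 := by
      rw [← pow_mul, show 2 * r * 2 = 4 * r by ring, hA.pow_eq_one]
    refine (sq_eq_one_iff.1 h2).resolve_left fun h => ?_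
    exact absurd (Nat.le_of_dvd (by omega) ((hA.pow_eq_one_iff_dvd _).1 h)) (by omega)
  have := isReflecting_of_pow (hA.ne_zero (by omega)) (by norm_num) hε (fun n h0 hn h => ?_) h1
  · simpa using this
  · exact absurd (Nat.le_of_dvd (by omega) ((hA.pow_eq_one_iff_dvd _).1 h)) (by omega)

lemma IsReflecting.qInt_two {A s : ℂ} (h : IsReflecting 3 A s) : qInt A 2 = s := by
  have h1 := h.refl 1 (by norm_num)
  have h2 := h.ne_zero 1 (by norm_num) (by norm_num)
  have h3 : qInt A 1 = 1 := by
    rw [qInt] at h2 ⊢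
    exact div_self (by simpa using (div_ne_zero_iff.1 h2).2)
  rwa [h3, mul_one] at h1

lemma IsReflecting.eta_three_sq {A s : ℂ} (h : IsReflecting 3 A s) : eta 3 A ^ 2 = 1 / 2 := by
  have h2 := h.ne_zero 2 (by norm_num) (by norm_num)
  have h1 := h.qInt_two
  have h3 : A ^ 2 - (A ^ 2)⁻¹ ≠ 0 := by
    intro hz
    rw [qInt, hz, div_zero] at h2
    exact h2 rfl
  have hA : A ^ 2 ≠ 0 := by
    intro hz
    simp [hz] at h3
  rw [qInt, div_eq_iff h3] at h1
  have h4 : A ^ 2 + (A ^ 2)⁻¹ = s := by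
    apply mul_right_cancel₀ h3
    rw [← h1]
    have : A ^ (2 * 2) = A ^ 2 * A ^ 2 := by ring
    rw [this, mul_inv]
    ring
  have h5 : (A ^ 2 - (A ^ 2)⁻¹) ^ 2 = -3 := by
    linear_combination (A ^ 2 + (A ^ 2)⁻¹ + s) * h4 + h.sq - 4 * mul_inv_cancel₀ hA
  rw [eta, div_pow, h5, mul_pow, Complex.I_sq, ← Complex.ofReal_pow, Real.sq_sqrt (by positivity)]
  norm_num

lemma eta_sq (r : ℕ) (A : ℂ) : eta r A ^ 2 = 1 / 2 * etaSO3 r A ^ 2 := by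
  rw [eta, etaSO3, div_pow, div_pow, mul_pow, mul_pow, ← Complex.ofReal_pow, ← Complex.ofReal_pow,
    Real.sq_sqrt (by positivity), Real.sq_sqrt (by positivity)]
  push_cast
  rw [div_mul_div_comm]
  congr 1 <;> ring

end QuantumNumber

namespace TetGluing

variable {T : Type*} (X : TetGluing T)

/-- The other side of a face, a face being given by a tetrahedron and the opposite vertex. -/
def glue (p : T × Fin 4) : T × Fin 4 := (X.adj p.1 p.2, X.perm p.1 p.2 p.2)

lemma glue_glue (p : T × Fin 4) : X.glue (X.glue p) = p := by
  refine Prod.ext (X.adj_adj _ _) ?_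
  change X.perm (X.adj p.1 p.2) (X.perm p.1 p.2 p.2) (X.perm p.1 p.2 p.2) = p.2
  rw [X.perm_adj]
  simp

lemma glue_ne (p : T × Fin 4) : X.glue p ≠ p := fun h =>
  X.ne_self p.1 p.2 ⟨congrArg Prod.fst h, congrArg Prod.snd h⟩

/-- The class of a face of a tetrahedron. -/
def face (p : T × Fin 4) : X.Face := Quot.mk X.FaceRel p

lemma face_glue (p : T × Fin 4) : X.face (X.glue p) = X.face p := Quot.sound (r := X.FaceRel) rfl |>.symm

lemma face_out (f : X.Face) : X.face (Quot.out f) = f := Quot.out_eq f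

lemma face_eq_iff (p q : T × Fin 4) : X.face p = X.face q ↔ p = q ∨ p = X.glue q := by
  constructor
  · intro h
    have key : ∀ a b, Relation.EqvGen X.FaceRel a b → a = b ∨ a = X.glue b := by
      intro a b hab
      induction hab with
      | rel a b hab => right; rw [show b = X.glue a from hab, glue_glue]
      | refl a => exact .inl rfl
      | symm a b _ ih =>
        rcases ih with rfl | rfl
        · exact .inl rfl
        · exact .inr (X.glue_glue _).symm
      | trans a b c _ _ h1 h2 =>
        rcases h1 with rfl | rfl <;> rcases h2 with rfl | rfl <;> simp [glue_glue]
    exact key p q (Quot.eqvGen_exact h)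
  · rintro (rfl | rfl)
    · rfl
    · exact X.face_glue q

lemma edge_symm (t : T) {j k : Fin 4} (h : j ≠ k) : X.edge t j k h = X.edge t k j h.symm :=
  Subtype.ext (by simp only [edge, edgeCell, Finset.pair_comm])

lemma cell_adj {t : T} {i : Fin 4} (x : LocalCell) (hi : i ∉ x.2) :
    X.cell (X.adj t i) (x.map (X.perm t i)) = X.cell t x :=
  (Quot.sound ⟨i, hi, rfl⟩).symm

lemma edge_adj {t : T} {i j k : Fin 4} (h : j ≠ k) (hj : i ≠ j) (hk : i ≠ k) :
    X.edge (X.adj t i) (X.perm t i j) (X.perm t i k) ((X.perm t i).injective.ne h) =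
      X.edge t j k h := by
  refine Subtype.ext ?_
  have := X.cell_adj (t := t) (i := i) (none, {j, k}) (by simp [hj, hk])
  rw [LocalCell.map] at this
  simpa [edge, edgeCell] using this

/-- A function of the three edges of a face. -/
def faceApply {γ : Sort*} (g : X.Edge → X.Edge → X.Edge → γ) (p : T × Fin 4) : γ :=
  g (X.edge p.1 (p.2.succAbove 0) (p.2.succAbove 1)
      (p.2.succAbove_right_injective.ne (by decide)))
    (X.edge p.1 (p.2.succAbove 0) (p.2.succAbove 2)
      (p.2.succAbove_right_injective.ne (by decide)))
    (X.edge p.1 (p.2.succAbove 1) (p.2.succAbove 2)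
      (p.2.succAbove_right_injective.ne (by decide)))

lemma succAbove_cases : ∀ i a b d : Fin 4, [i, a, b, d].Nodup →
    (a, b, d) ∈ [(i.succAbove 0, i.succAbove 1, i.succAbove 2),
      (i.succAbove 0, i.succAbove 2, i.succAbove 1),
      (i.succAbove 1, i.succAbove 0, i.succAbove 2),
      (i.succAbove 1, i.succAbove 2, i.succAbove 0),
      (i.succAbove 2, i.succAbove 0, i.succAbove 1),
      (i.succAbove 2, i.succAbove 1, i.succAbove 0)] := by
  decide

section
variable {X} {γ : Sort*} {g : X.Edge → X.Edge → X.Edge → γ} (h1 : ∀ i j k, g j i k = g i j k)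
  (h2 : ∀ i j k, g i k j = g i j k)
include h1 h2

lemma faceApply_eq {t : T} {i a b d : Fin 4} (hia : i ≠ a) (hib : i ≠ b) (hid : i ≠ d)
    (hab : a ≠ b) (had : a ≠ d) (hbd : b ≠ d) :
    X.faceApply g (t, i) = g (X.edge t a b hab) (X.edge t a d had) (X.edge t b d hbd) := by
  have h := succAbove_cases i a b d (by simp [*])
  simp only [List.mem_cons, List.not_mem_nil, or_false, Prod.mk.injEq] at h
  rcases h with
    ⟨rfl, rfl, rfl⟩ | ⟨rfl, rfl, rfl⟩ | ⟨rfl, rfl, rfl⟩ | ⟨rfl, rfl, rfl⟩ | ⟨rfl, rfl, rfl⟩ |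
    ⟨rfl, rfl, rfl⟩
  · rfl
  · rw [X.edge_symm t hbd, h1]; rfl
  · rw [X.edge_symm t hab, h2]; rfl
  · rw [X.edge_symm t had, X.edge_symm t hbd, h1, h2]; rfl
  · rw [X.edge_symm t hab, X.edge_symm t had, h2, h1]; rfl
  · rw [X.edge_symm t had, X.edge_symm t hab, X.edge_symm t hbd, h1, h2, h1]; rfl

lemma faceApply_glue (p : T × Fin 4) : X.faceApply g (X.glue p) = X.faceApply g p := by
  obtain ⟨t, i⟩ := p
  have hs := i.succAbove_ne
  have inj := (X.perm t i).injective
  have hne : ∀ {a b : Fin 3}, a ≠ b → i.succAbove a ≠ i.succAbove b := fun h =>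
    i.succAbove_right_injective.ne h
  rw [glue, faceApply_eq h1 h2 (inj.ne (hs 0).symm) (inj.ne (hs 1).symm) (inj.ne (hs 2).symm)
    (inj.ne (hne (by decide))) (inj.ne (hne (by decide))) (inj.ne (hne (by decide))),
    X.edge_adj (hne (by decide)) (hs _).symm (hs _).symm,
    X.edge_adj (hne (by decide)) (hs _).symm (hs _).symm,
    X.edge_adj (hne (by decide)) (hs _).symm (hs _).symm]
  rfl

end

section
variable {β : Type*}

/-- The value on the edge joining `j` and `k`, zero if `j = k`. -/
def edgeVal [Zero β] (c : X.Edge → β) (t : T) (j k : Fin 4) : β :=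
  if h : j ≠ k then c (X.edge t j k h) else 0

lemma edgeVal_of_ne [Zero β] (c : X.Edge → β) (t : T) {j k : Fin 4} (h : j ≠ k) :
    X.edgeVal c t j k = c (X.edge t j k h) := dif_pos h

lemma edgeVal_symm [Zero β] (c : X.Edge → β) (t : T) (j k : Fin 4) :
    X.edgeVal c t j k = X.edgeVal c t k j := by
  by_cases h : j = k
  · rw [h]
  · rw [X.edgeVal_of_ne _ _ h, X.edgeVal_of_ne _ _ (Ne.symm h), edge_symm]

lemma edgeVal_adj [Zero β] (c : X.Edge → β) {t : T} {i j k : Fin 4} (hj : i ≠ j) (hk : i ≠ k) :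
    X.edgeVal c (X.adj t i) (X.perm t i j) (X.perm t i k) = X.edgeVal c t j k := by
  by_cases h : j = k
  · simp [edgeVal, h]
  · rw [X.edgeVal_of_ne _ _ h, X.edgeVal_of_ne _ _ ((X.perm t i).injective.ne h),
      X.edge_adj h hj hk]

end

variable [Fintype T]

@[to_additive]
lemma prod_faces {β : Type*} [CommMonoid β] (G : T × Fin 4 → β) :
    ∏ p, G p = ∏ f : X.Face, G (Quot.out f) * G (X.glue (Quot.out f)) := by
  classical
  rw [← Finset.prod_fiberwise Finset.univ X.face]
  refine Finset.prod_congr rfl fun f _ => ?_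
  rw [← Finset.prod_pair (X.glue_ne _).symm]
  refine Finset.prod_congr ?_ fun _ _ => rfl
  ext p
  rw [Finset.mem_filter, ← X.face_out f, face_eq_iff, X.face_out]
  simp

lemma sum_eq_zero_of_glue {G : T × Fin 4 → ZMod 2} (hG : ∀ p, G (X.glue p) = G p) :
    ∑ p, G p = 0 := by
  rw [X.sum_faces]
  exact Finset.sum_eq_zero fun f _ => by rw [hG, CharTwo.add_self_eq_zero]

open Classical in
lemma sum_mul_sum_face_eq (σ : T → ZMod 2) (p : T × Fin 4) :
    ∑ t, σ t * ∑ i, (if X.face (t, i) = X.face p then 1 else 0) =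
      σ p.1 + σ (X.glue p).1 := by
  simp only [Finset.mul_sum, mul_ite, mul_one, mul_zero, X.face_eq_iff]
  rw [← Fintype.sum_prod_type' fun t i => if (t, i) = p ∨ (t, i) = X.glue p then σ t else 0,
    ← Finset.sum_filter,
    ← Finset.sum_pair (f := fun q : T × Fin 4 => σ q.1) (X.glue_ne p).symm]
  refine Finset.sum_congr ?_ fun _ _ => rfl
  ext q
  simp

/-- A function of the six edges of a tetrahedron. -/
def tetApply {γ : Sort*} (g : X.Edge → X.Edge → X.Edge → X.Edge → X.Edge → X.Edge → γ) (t : T) :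
    γ :=
  g (X.edge t 0 1 (by decide)) (X.edge t 0 2 (by decide)) (X.edge t 1 2 (by decide))
    (X.edge t 2 3 (by decide)) (X.edge t 1 3 (by decide)) (X.edge t 0 3 (by decide))

lemma sum_edges_nat (n : X.Edge → ℕ) :
    ∑ t, X.tetApply (fun i j k l m o => n i + n j + n k + n l + n m + n o) t =
      ∑ f : X.Face, X.faceApply (fun i j k => n i + n j + n k) (Quot.out f) := by
  have h1 : ∑ p, X.faceApply (fun i j k => n i + n j + n k) p =
      2 * ∑ f : X.Face, X.faceApply (fun i j k => n i + n j + n k) (Quot.out f) := by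
    rw [X.sum_faces, Finset.mul_sum]
    refine Finset.sum_congr rfl fun f _ => ?_
    rw [faceApply_glue (fun i j k => by ring) (fun i j k => by ring), two_mul]
  have h2 : ∑ p, X.faceApply (fun i j k => n i + n j + n k) p =
      2 * ∑ t, X.tetApply (fun i j k l m o => n i + n j + n k + n l + n m + n o) t := by
    rw [Fintype.sum_prod_type, Finset.mul_sum]
    refine Finset.sum_congr rfl fun t _ => ?_
    rw [Fin.sum_univ_four]
    change n (X.edge t 1 2 _) + n (X.edge t 1 3 _) + n (X.edge t 2 3 _) +
      (n (X.edge t 0 2 _) + n (X.edge t 0 3 _) + n (X.edge t 2 3 _)) +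
      (n (X.edge t 0 1 _) + n (X.edge t 0 3 _) + n (X.edge t 1 3 _)) +
      (n (X.edge t 0 1 _) + n (X.edge t 0 2 _) + n (X.edge t 1 2 _)) = _
    rw [tetApply]
    ring
  omega

lemma prod_edges {β : Type*} [CommMonoid β] (h : X.Edge → β) :
    ∏ t, X.tetApply (fun i j k l m o => h i * h j * h k * h l * h m * h o) t =
      ∏ f : X.Face, X.faceApply (fun i j k => h i * h j * h k) (Quot.out f) := by
  classical
  have h0 : ∀ e', h e' = ∏ e, h e ^ (if e' = e then 1 else 0) := fun e' => by
    simp [pow_ite, Finset.prod_ite_eq]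
  have h1 : ∏ t, X.tetApply (fun i j k l m o => h i * h j * h k * h l * h m * h o) t =
      ∏ e, h e ^ ∑ t, X.tetApply (fun i j k l m o => (if i = e then 1 else 0) +
        (if j = e then 1 else 0) + (if k = e then 1 else 0) + (if l = e then 1 else 0) +
        (if m = e then 1 else 0) + (if o = e then 1 else 0)) t := by
    simp only [← Finset.prod_pow_eq_pow_sum]
    rw [Finset.prod_comm]
    refine Finset.prod_congr rfl fun t _ => ?_
    simp only [tetApply, pow_add, Finset.prod_mul_distrib, ← h0]
  have h2 : ∏ f : X.Face, X.faceApply (fun i j k => h i * h j * h k) (Quot.out f) =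
      ∏ e, h e ^ ∑ f : X.Face, X.faceApply (fun i j k => (if i = e then 1 else 0) +
        (if j = e then 1 else 0) + (if k = e then 1 else 0)) (Quot.out f) := by
    simp only [← Finset.prod_pow_eq_pow_sum]
    rw [Finset.prod_comm]
    refine Finset.prod_congr rfl fun t _ => ?_
    simp only [faceApply, pow_add, Finset.prod_mul_distrib, ← h0]
  rw [h1, h2]
  refine Finset.prod_congr rfl fun e _ => ?_
  rw [X.sum_edges_nat fun i => if i = e then 1 else 0]

end TetGluing

namespace TetGluing

variable {T : Type*} (X : TetGluing T)

/-- No edge is identified with itself in the reversed direction. -/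
def EdgesNotReversed : Prop := ∀ (t : T) (j k : Fin 4), j ≠ k →
  X.cell t (some j, {j, k}) ≠ X.cell t (some k, {j, k})

lemma exists_orientation [Finite T] (hX : X.EdgesNotReversed) :
    ∃ o : T → Fin 4 → Fin 4 → ZMod 2, (∀ t j k, j ≠ k → o t j k + o t k j = 1) ∧
      ∀ t i j k, i ≠ j → i ≠ k →
        o (X.adj t i) (X.perm t i j) (X.perm t i k) = o t j k := by
  classical
  obtain ⟨n, ⟨e⟩⟩ := Finite.exists_equiv_fin X.Cell
  refine ⟨fun t j k => if e (X.cell t (some j, {j, k})) < e (X.cell t (some k, {j, k})) then 1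
    else 0, fun t j k hjk => ?_, fun t i j k hj hk => ?_⟩
  · have h := e.injective.ne (hX t j k hjk)
    simp only [Finset.pair_comm k j]
    rcases lt_or_gt_of_ne h with h | h
    · simp [h, h.not_gt]
    · simp [h, h.not_gt]
  · have h (m : Fin 4) := X.cell_adj (t := t) (i := i) (some m, {j, k}) (by simp [hj, hk])
    simp only [LocalCell.map, Option.map_some, Finset.map_insert, Finset.map_singleton,
      Equiv.coe_toEmbedding] at h
    simp only [h]

/-- The colorings of the edges by `ℤ/2` that sum up to zero on each face. -/
def cocycles : Submodule (ZMod 2) (X.Edge → ZMod 2) where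
  carrier := {a | ∀ p, X.faceApply (fun i j k => a i + a j + a k) p = 0}
  add_mem' {a b} ha hb p := by
    have := congrArg₂ (· + ·) (ha p) (hb p)
    simp only [faceApply, add_zero, Pi.add_apply] at this ⊢
    rw [← this]
    ring
  zero_mem' p := by simp [faceApply]
  smul_mem' r a ha p := by
    have := congrArg (r * ·) (ha p)
    simp only [faceApply, mul_zero, Pi.smul_apply, smul_eq_mul] at this ⊢
    rw [← this]
    ring

variable {X}

lemma edgeVal_add_edgeVal {a : X.Edge → ZMod 2} (ha : a ∈ X.cocycles) (t : T) {j k l : Fin 4}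
    (hjk : j ≠ k) (hjl : j ≠ l) (hkl : k ≠ l) :
    X.edgeVal a t j k + X.edgeVal a t j l = X.edgeVal a t k l := by
  obtain ⟨i, hj, hk, hl⟩ : ∃ i, i ≠ j ∧ i ≠ k ∧ i ≠ l := by
    revert j k l; decide
  have h := ha (t, i)
  rw [faceApply_eq (fun i j k => by ring) (fun i j k => by ring) hj hk hl hjk hjl hkl] at h
  rw [X.edgeVal_of_ne _ _ hjk, X.edgeVal_of_ne _ _ hjl, X.edgeVal_of_ne _ _ hkl]
  exact CharTwo.add_eq_zero.1 h

lemma edgeVal_zero_add_edgeVal_zero {c : X.Edge → ZMod 2} (hc : c ∈ X.cocycles) (t : T)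
    (j k : Fin 4) : X.edgeVal c t 0 j + X.edgeVal c t 0 k = X.edgeVal c t j k := by
  by_cases hj : (0 : Fin 4) = j
  · subst hj; simp [edgeVal]
  by_cases hk : (0 : Fin 4) = k
  · subst hk
    rw [X.edgeVal_symm c t 0 j]; simp [edgeVal]
  by_cases hjk : j = k
  · subst hjk
    rw [CharTwo.add_self_eq_zero]; simp [edgeVal]
  exact edgeVal_add_edgeVal hc t hj hk hjk

lemma sum_mul_opposite [Fintype T] (hX : X.EdgesNotReversed) {a : X.Edge → ZMod 2}
    (ha : a ∈ X.cocycles) (x : X.Edge → ZMod 2) :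
    ∑ t, X.tetApply (fun i j k l m n =>
      x i * a l + x j * a m + x k * a n + x l * a i + x m * a j + x n * a k) t = 0 := by
  obtain ⟨o, ho, ho'⟩ := X.exists_orientation hX
  let H : T × Fin 4 → ZMod 2 := fun p => ∑ j, ∑ k, ∑ l, if [p.2, j, k, l].Nodup then
    o p.1 j k * X.edgeVal x p.1 j k * X.edgeVal a p.1 j l else 0
  have hH : ∀ p, H (X.glue p) = H p := by
    rintro ⟨t, i⟩
    simp only [H, glue]
    rw [← Equiv.sum_comp (X.perm t i)]
    refine Finset.sum_congr rfl fun j _ => ?_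
    rw [← Equiv.sum_comp (X.perm t i)]
    refine Finset.sum_congr rfl fun k _ => ?_
    rw [← Equiv.sum_comp (X.perm t i)]
    refine Finset.sum_congr rfl fun l _ => ?_
    have hn : [X.perm t i i, X.perm t i j, X.perm t i k, X.perm t i l].Nodup ↔
        [i, j, k, l].Nodup := List.nodup_map_iff (l := [i, j, k, l]) (X.perm t i).injective
    by_cases h : [i, j, k, l].Nodup
    · rw [if_pos h, if_pos (hn.2 h)]
      have hij : i ≠ j := by rintro rfl; simp at h
      have hik : i ≠ k := by rintro rfl; simp at h
      have hil : i ≠ l := by rintro rfl; simp at h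
      rw [ho' t i j k hij hik, X.edgeVal_adj x hij hik, X.edgeVal_adj a hij hil]
    · rw [if_neg h, if_neg fun h' => h (hn.1 h')]
  rw [← X.sum_eq_zero_of_glue hH, Fintype.sum_prod_type]
  refine Finset.sum_congr rfl fun t _ => ?_
  have key : ∀ j k l m : Fin 4, [j, k, l, m].Nodup →
      o t j k * X.edgeVal x t j k * X.edgeVal a t j l +
      o t j k * X.edgeVal x t j k * X.edgeVal a t j m +
      o t k j * X.edgeVal x t k j * X.edgeVal a t k l +
      o t k j * X.edgeVal x t k j * X.edgeVal a t k m =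
      X.edgeVal x t j k * X.edgeVal a t l m := by
    intro j k l m h
    simp only [List.nodup_cons, List.mem_cons, List.not_mem_nil, not_or] at h
    obtain ⟨⟨hjk, hjl, hjm, -⟩, ⟨hkl, hkm, -⟩, ⟨hlm, -⟩, -⟩ := h
    rw [X.edgeVal_symm x t k j]
    linear_combination o t j k * X.edgeVal x t j k * edgeVal_add_edgeVal ha t hjl hjm hlm +
      o t k j * X.edgeVal x t j k * edgeVal_add_edgeVal ha t hkl hkm hlm +
      X.edgeVal x t j k * X.edgeVal a t l m * ho t j k hjk
  simp only [H, Fin.sum_univ_four]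
  simp +decide only [if_true, if_false, add_zero, zero_add]
  have hx : ∀ (y : X.Edge → ZMod 2) {j k : Fin 4} (h : j ≠ k),
      y (X.edge t j k h) = X.edgeVal y t j k := fun y j k h => (X.edgeVal_of_ne y t h).symm
  simp only [tetApply, hx]
  have e1 := key 0 1 2 3 (by decide)
  have e2 := key 0 2 1 3 (by decide)
  have e3 := key 1 2 0 3 (by decide)
  have e4 := key 2 3 0 1 (by decide)
  have e5 := key 1 3 0 2 (by decide)
  have e6 := key 0 3 1 2 (by decide)
  linear_combination -e1 - e2 - e3 - e4 - e5 - e6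

end TetGluing

namespace QuantumNumber

lemma IsReflecting.qInt_one {r : ℕ} {A s : ℂ} (h : IsReflecting r A s) (hr : 1 < r) :
    qInt A 1 = 1 := by
  have h2 := h.ne_zero 1 one_pos hr
  rw [qInt] at h2 ⊢
  exact div_self (by simpa using (div_ne_zero_iff.1 h2).2)

end QuantumNumber

namespace TriangulatedThreeManifold

open QuantumNumber TetGluing

variable {T : Type*} (M : TriangulatedThreeManifold T)

lemma admissible_swap_right (r i j k : ℕ) : Admissible r i k j = Admissible r i j k := by
  simp only [Admissible, Nat.even_iff, eq_iff_iff]; constructor <;> (rintro ⟨_, _, _⟩; omega)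

lemma admissibleColoring_iff (r : ℕ) (c : M.Edge → ℕ) : M.AdmissibleColoring r c ↔
    ∀ p, M.faceApply (fun i j k => Admissible r (c i) (c j) (c k)) p := by
  have key (t : T) : (∀ i, M.faceApply (fun i j k => Admissible r (c i) (c j) (c k)) (t, i)) ↔
      Admissible r (c (M.edge t 1 2 (by decide))) (c (M.edge t 1 3 (by decide)))
        (c (M.edge t 2 3 (by decide))) ∧
      Admissible r (c (M.edge t 0 2 (by decide))) (c (M.edge t 0 3 (by decide)))
        (c (M.edge t 2 3 (by decide))) ∧
      Admissible r (c (M.edge t 0 1 (by decide))) (c (M.edge t 0 3 (by decide)))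
        (c (M.edge t 1 3 (by decide))) ∧
      Admissible r (c (M.edge t 0 1 (by decide))) (c (M.edge t 0 2 (by decide)))
        (c (M.edge t 1 2 (by decide))) :=
    ⟨fun h => ⟨h 0, h 1, h 2, h 3⟩, fun ⟨h0, h1, h2, h3⟩ i => by
      fin_cases i
      exacts [h0, h1, h2, h3]⟩
  simp only [Prod.forall, AdmissibleColoring, Admissible6, key]
  refine forall_congr' fun t => ?_
  rw [admissible_swap_right r (c (M.edge t 0 2 _)), admissible_swap_right r (c (M.edge t 1 2 _)),
    admissible_swap_right r (c (M.edge t 0 1 _)) (c (M.edge t 0 3 _))]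
  tauto

/-- The product of the weights of a coloring. -/
def weight (A : ℂ) [Fintype T] (c : M.Edge → ℕ) : ℂ :=
  ((∏ e : M.Edge, circle A (c e)) * ∏ t : T, M.tetWeight A c t) / ∏ f : M.Face, M.faceWeight A c f

variable [Fintype T]

lemma weight_eq {r : ℕ} {A s : ℂ} (h : IsReflecting r A s) (hr : 2 ≤ r) {c : M.Edge → ℕ}
    (hc : M.AdmissibleColoring r c) (hlt : ∀ e, c e < r) :
    M.weight A c = (∏ e, circle A (c e)) *
      (∏ t, M.tetApply (fun i j k l m n =>
        racahSum A (faceSum (c i) (c j) (c k) (c l) (c m) (c n))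
          (quadSum (c i) (c j) (c k) (c l) (c m) (c n))) t) *
      ∏ f : M.Face, M.faceApply (fun i j k => faceFactor A (c i) (c j) (c k)) (Quot.out f) := by
  set C : T × Fin 4 → ℂ := M.faceApply (fun i j k => cornerFact A (c i) (c j) (c k)) with hC
  have hl : ∀ i j k : M.Edge, cornerFact A (c j) (c i) (c k) = cornerFact A (c i) (c j) (c k) :=
    fun i j k => cornerFact_swap_left _ _ _ _
  have hr' : ∀ i j k : M.Edge, cornerFact A (c i) (c k) (c j) = cornerFact A (c i) (c j) (c k) :=
    fun i j k => cornerFact_swap_right _ _ _ _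
  set W : ℂ := ∏ t, M.tetApply (fun i j k l m n => qFact A (c i) * qFact A (c j) * qFact A (c k) *
    qFact A (c l) * qFact A (c m) * qFact A (c n)) t with hW
  have hW' : W = ∏ f : M.Face, M.faceApply (fun i j k => qFact A (c i) * qFact A (c j) *
      qFact A (c k)) (Quot.out f) := M.prod_edges fun e => qFact A (c e)
  have hW0 : W ≠ 0 := by
    rw [hW']
    exact Finset.prod_ne_zero_iff.2 fun f _ => mul_ne_zero (mul_ne_zero (h.qFact_ne_zero (hlt _))
      (h.qFact_ne_zero (hlt _))) (h.qFact_ne_zero (hlt _))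
  have hC0 : ∀ p, C p ≠ 0 := fun p =>
    h.cornerFact_ne_zero hr ((M.admissibleColoring_iff r c).1 hc p)
  have hCC : ∏ p, C p = (∏ f : M.Face, C (Quot.out f)) * ∏ f : M.Face, C (Quot.out f) := by
    rw [M.prod_faces, ← Finset.prod_mul_distrib]
    exact Finset.prod_congr rfl fun f _ => by rw [hC, faceApply_glue hl hr']
  have ht : ∏ t, M.tetWeight A c t = (∏ p, C p) / W * ∏ t, M.tetApply (fun i j k l m n =>
        racahSum A (faceSum (c i) (c j) (c k) (c l) (c m) (c n))
          (quadSum (c i) (c j) (c k) (c l) (c m) (c n))) t := by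
    rw [Fintype.prod_prod_type, hW, ← Finset.prod_div_distrib, ← Finset.prod_mul_distrib]
    refine Finset.prod_congr rfl fun t _ => ?_
    rw [tetWeight, tetra_eq A (hc t), Fin.prod_univ_four]
    change _ = (cornerFact A (c (M.edge t 1 2 _)) (c (M.edge t 1 3 _)) (c (M.edge t 2 3 _)) *
      cornerFact A (c (M.edge t 0 2 _)) (c (M.edge t 0 3 _)) (c (M.edge t 2 3 _)) *
      cornerFact A (c (M.edge t 0 1 _)) (c (M.edge t 0 3 _)) (c (M.edge t 1 3 _)) *
      cornerFact A (c (M.edge t 0 1 _)) (c (M.edge t 0 2 _)) (c (M.edge t 1 2 _))) / _ * _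
    rw [tetApply, tetApply, hr' (M.edge t 0 2 _), hr' (M.edge t 1 2 _),
      hr' (M.edge t 0 1 _) (M.edge t 0 3 _)]
    congr 2
    ring
  have hf : ∏ f : M.Face, M.faceWeight A c f = (∏ f : M.Face, C (Quot.out f)) *
      (∏ f : M.Face, M.faceApply (fun i j k => (-1) ^ ((c i + c j + c k) / 2) *
        qFact A ((c i + c j + c k) / 2 + 1)) (Quot.out f)) / W := by
    rw [hW', ← Finset.prod_mul_distrib, ← Finset.prod_div_distrib]
    refine Finset.prod_congr rfl fun f _ => ?_
    simp only [faceWeight, theta_eq, hC, faceApply]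
    ring
  have hΦ : ∏ f : M.Face, M.faceApply (fun i j k => faceFactor A (c i) (c j) (c k)) (Quot.out f) =
      (∏ f : M.Face, C (Quot.out f)) *
      (∏ f : M.Face, M.faceApply (fun i j k => (-1) ^ ((c i + c j + c k) / 2) *
        qFact A ((c i + c j + c k) / 2 + 1)) (Quot.out f))⁻¹ := by
    rw [← Finset.prod_inv_distrib, ← Finset.prod_mul_distrib]
    refine Finset.prod_congr rfl fun f _ => ?_
    simp only [faceFactor, hC, faceApply]
    rw [mul_inv, ← inv_pow, inv_neg_one]
    ring
  have hP : ∏ f : M.Face, C (Quot.out f) ≠ 0 := Finset.prod_ne_zero_iff.2 fun f _ => hC0 _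
  rw [weight, ht, hf, hΦ, hCC]
  field_simp

/-- The sign by which a recoloring changes the weight of an even coloring. -/
def recolorSign (ε : ℂ) (a : M.Edge → ℕ) : ℂ :=
  (∏ e, ε ^ a e) *
    (∏ t, ε ^ M.tetApply (fun i j k l m n =>
      if a i + a j + a k + a l + a m + a n = 0 then 0 else 1) t) *
    ∏ f : M.Face, ε ^ M.faceApply (fun i j k => (a i + a j + a k) / 2) (Quot.out f)

lemma weight_recolor {r ρ : ℕ} {A s : ℂ} (h : IsReflecting r A s) (hr : r = 2 * ρ + 3)
    {a x : M.Edge → ℕ} (ha : M.AdmissibleColoring 3 a) (ha1 : ∀ e, a e ≤ 1)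
    (hx : M.AdmissibleColoring r fun e => 2 * x e) (hxρ : ∀ e, x e ≤ ρ) :
    M.weight A (fun e => recolor r (a e) (2 * x e)) =
      M.recolorSign (-s) a * M.weight A (fun e => 2 * x e) := by
  have hs : (-s) * (-s) = 1 := by rw [neg_mul_neg, h.sq]
  have hfa := (M.admissibleColoring_iff 3 a).1 ha
  have hfx := (M.admissibleColoring_iff r _).1 hx
  have hc : M.AdmissibleColoring r fun e => recolor r (a e) (2 * x e) :=
    (M.admissibleColoring_iff r _).2 fun p =>
      (admissible_recolor hr (ha1 _) (ha1 _) (ha1 _) (hxρ _) (hxρ _) (hxρ _)).2 ⟨hfa p, hfx p⟩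
  have hcoc : (fun e => (a e : ZMod 2)) ∈ M.cocycles := fun p => by
    have := (hfa p).2.1
    simp only [faceApply] at this ⊢
    exact_mod_cast ZMod.natCast_eq_zero_iff_even.2 this
  have hodd : Even (∑ t, M.tetApply (fun i j k l m n => x i * a l + x j * a m + x k * a n +
      x l * a i + x m * a j + x n * a k) t) := by
    rw [← ZMod.natCast_eq_zero_iff_even,
      ← sum_mul_opposite M.edge_not_reversed hcoc fun e => (x e : ZMod 2)]
    simp [tetApply]
  have heven := fun p => (hfa p).2.1
  have ht : ∏ t, M.tetApply (fun i j k l m n =>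
        racahSum A (faceSum (recolor r (a i) (2 * x i)) (recolor r (a j) (2 * x j))
          (recolor r (a k) (2 * x k)) (recolor r (a l) (2 * x l)) (recolor r (a m) (2 * x m))
          (recolor r (a n) (2 * x n)))
          (quadSum (recolor r (a i) (2 * x i)) (recolor r (a j) (2 * x j))
          (recolor r (a k) (2 * x k)) (recolor r (a l) (2 * x l)) (recolor r (a m) (2 * x m))
          (recolor r (a n) (2 * x n)))) t =
      (∏ t, (-s) ^ M.tetApply (fun i j k l m n =>
        if a i + a j + a k + a l + a m + a n = 0 then 0 else 1) t) *
      ∏ t, M.tetApply (fun i j k l m n =>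
        racahSum A (faceSum (2 * x i) (2 * x j) (2 * x k) (2 * x l) (2 * x m) (2 * x n))
          (quadSum (2 * x i) (2 * x j) (2 * x k) (2 * x l) (2 * x m) (2 * x n))) t := by
    have hone : ∏ t, (-s) ^ M.tetApply (fun i j k l m n => x i * a l + x j * a m + x k * a n +
      x l * a i + x m * a j + x n * a k) t = 1 := by
      rw [Finset.prod_pow_eq_pow_sum]
      obtain ⟨q, hq⟩ := hodd
      rw [hq, pow_add, ← mul_pow, hs, one_pow]
    rw [← mul_one (∏ t, (-s) ^ _), ← hone, ← Finset.prod_mul_distrib, ← Finset.prod_mul_distrib]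
    refine Finset.prod_congr rfl fun t _ => ?_
    have h0 : Even (a (M.edge t 1 2 _) + a (M.edge t 1 3 _) + a (M.edge t 2 3 _)) := heven (t, 0)
    have h1 : Even (a (M.edge t 0 2 _) + a (M.edge t 0 3 _) + a (M.edge t 2 3 _)) := heven (t, 1)
    have h2 : Even (a (M.edge t 0 1 _) + a (M.edge t 0 3 _) + a (M.edge t 1 3 _)) := heven (t, 2)
    simp only [tetApply]
    rw [h.racahSum_recolor hr (ha1 _) (ha1 _) (ha1 _) (ha1 _) (ha1 _) (ha1 _)
      (by convert h2 using 1; ring) (by convert h1 using 1; ring) (by convert h0 using 1; ring)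
      (hxρ _) (hxρ _) (hxρ _) (hxρ _) (hxρ _) (hxρ _), pow_add]
  have hle : ∀ e, 2 * x e + 2 ≤ r := fun e => by have := hxρ e; omega
  rw [M.weight_eq h (by omega) hc fun e => by
      have := hle e; unfold recolor; split_ifs <;> omega,
    M.weight_eq h (by omega) hx fun e => by have := hle e; omega, ht]
  have hodd_r : Odd r := ⟨ρ + 1, by omega⟩
  have hcirc : ∏ e, circle A (recolor r (a e) (2 * x e)) =
      (∏ e, (-s) ^ a e) * ∏ e, circle A (2 * x e) := by
    rw [← Finset.prod_mul_distrib]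
    exact Finset.prod_congr rfl fun e _ => h.circle_recolor hodd_r (ha1 e) (hle e)
  have hface : ∏ f : M.Face, M.faceApply (fun i j k => faceFactor A (recolor r (a i) (2 * x i))
        (recolor r (a j) (2 * x j)) (recolor r (a k) (2 * x k))) (Quot.out f) =
      (∏ f : M.Face, (-s) ^ M.faceApply (fun i j k => (a i + a j + a k) / 2) (Quot.out f)) *
      ∏ f : M.Face, M.faceApply (fun i j k => faceFactor A (2 * x i) (2 * x j) (2 * x k))
        (Quot.out f) := by
    rw [← Finset.prod_mul_distrib]
    exact Finset.prod_congr rfl fun f _ =>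
      h.faceFactor_recolor hr (ha1 _) (ha1 _) (ha1 _) (heven _) (hfx _)
  rw [hcirc, hface, recolorSign]
  ring

lemma weight_zero {A s : ℂ} {r : ℕ} (h : IsReflecting r A s) (hr : 1 < r) :
    M.weight A (fun _ => 0) = 1 := by
  have h1 := h.qInt_one hr
  have hc : circle A 0 = 1 := by simp [circle, h1]
  have ht : theta A 0 0 0 = 1 := by simp [theta, qFact, h1]
  have hτ : tetra A 0 0 0 0 0 0 = 1 := by
    have e1 : faceSum 0 0 0 0 0 0 = fun _ => 0 := by ext i; fin_cases i <;> rfl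
    have e2 : quadSum 0 0 0 0 0 0 = fun _ => 0 := by ext i; fin_cases i <;> rfl
    simp [tetra, qFact, h1, e1, e2]
  simp [weight, tetWeight, faceWeight, hc, ht, hτ]

lemma weight_three {A s : ℂ} (h : IsReflecting 3 A s) {a : M.Edge → ℕ}
    (ha : M.AdmissibleColoring 3 a) (ha1 : ∀ e, a e ≤ 1) :
    M.weight A a = M.recolorSign (-s) a := by
  have h0 : M.AdmissibleColoring 3 fun _ => 2 * 0 := fun t => by
    simp [Admissible6, Admissible]
  have := M.weight_recolor (ρ := 0) h rfl ha ha1 h0 fun _ => le_rfl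
  rw [M.weight_zero h (by norm_num), mul_one] at this
  rw [← this]
  congr 1
  ext e
  rcases Nat.le_one_iff_eq_zero_or_eq_one.1 (ha1 e) with h | h <;> simp [h, recolor]

lemma stateSum_eq (r : ℕ) (A : ℂ) (I : Finset ℕ) :
    M.stateSum r A I = ∑ c ∈ M.admissibleColorings r I, M.weight A c := rfl

lemma mem_admissibleColorings {r : ℕ} {I : Finset ℕ} {c : M.Edge → ℕ} :
    c ∈ M.admissibleColorings r I ↔ (∀ e, c e ∈ I) ∧ M.AdmissibleColoring r c := by
  simp [admissibleColorings]

lemma stateSum_eq_mul {r : ℕ} {A A₃ s : ℂ} (h : IsReflecting r A s) (h₃ : IsReflecting 3 A₃ s)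
    (hr : 3 ≤ r) (hodd : Odd r) :
    M.stateSum r A (colors r) =
      M.stateSum 3 A₃ (colors 3) * M.stateSum r A (colorsSO3 r) := by
  obtain ⟨ρ, rfl⟩ : ∃ ρ, r = 2 * ρ + 3 := by
    obtain ⟨k, rfl⟩ := hodd
    exact ⟨k - 1, by omega⟩
  rw [stateSum_eq, stateSum_eq, stateSum_eq, Finset.sum_mul_sum, ← Finset.sum_product']
  have hmem3 : ∀ {a : M.Edge → ℕ}, a ∈ M.admissibleColorings 3 (colors 3) →
      (∀ e, a e ≤ 1) ∧ M.AdmissibleColoring 3 a := fun ha => by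
    rw [mem_admissibleColorings] at ha
    exact ⟨fun e => by have := Finset.mem_range.1 (ha.1 e); omega, ha.2⟩
  have hmem' : ∀ {c : M.Edge → ℕ}, c ∈ M.admissibleColorings (2 * ρ + 3) (colorsSO3 (2 * ρ + 3)) →
      ∃ x : M.Edge → ℕ, (∀ e, x e ≤ ρ) ∧ c = (fun e => 2 * x e) ∧
        M.AdmissibleColoring (2 * ρ + 3) c := fun {c} hc => by
    rw [mem_admissibleColorings] at hc
    have hx : ∀ e, ∃ x, x ≤ ρ ∧ c e = 2 * x := fun e => by
      obtain ⟨h1, x, hx⟩ := Finset.mem_filter.1 (hc.1 e)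
      have := Finset.mem_range.1 h1
      exact ⟨x, by omega, by rw [hx]; ring⟩
    choose x hx1 hx2 using hx
    exact ⟨x, hx1, funext hx2, hc.2⟩
  symm
  refine Finset.sum_bij' (fun p _ => fun e => recolor (2 * ρ + 3) (p.1 e) (p.2 e))
    (fun c _ => (fun e => c e % 2, fun e => if c e % 2 = 0 then c e else 2 * ρ + 1 - c e))
    ?_ ?_ ?_ ?_ ?_
  · rintro ⟨a, c⟩ hp
    rw [Finset.mem_product] at hp
    obtain ⟨ha1, ha⟩ := hmem3 hp.1
    obtain ⟨x, hx, rfl, hc⟩ := hmem' hp.2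
    rw [mem_admissibleColorings]
    refine ⟨fun e => Finset.mem_range.2 ?_, (M.admissibleColoring_iff _ _).2 fun p =>
      (admissible_recolor rfl (ha1 _) (ha1 _) (ha1 _) (hx _) (hx _) (hx _)).2
        ⟨(M.admissibleColoring_iff _ _).1 ha p, (M.admissibleColoring_iff _ _).1 hc p⟩⟩
    have := hx e
    dsimp only [recolor]
    split_ifs <;> omega
  · intro c hc
    rw [mem_admissibleColorings] at hc
    have hlt : ∀ e, c e < 2 * ρ + 2 := fun e => Finset.mem_range.1 (hc.1 e)
    obtain ⟨x, hx⟩ : ∃ x : M.Edge → ℕ, ∀ e, x e ≤ ρ ∧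
        (if c e % 2 = 0 then c e else 2 * ρ + 1 - c e) = 2 * x e ∧
        c e = recolor (2 * ρ + 3) (c e % 2) (2 * x e) := by
      refine ⟨fun e => (if c e % 2 = 0 then c e else 2 * ρ + 1 - c e) / 2, fun e => ?_⟩
      have := hlt e
      dsimp only [recolor]
      split_ifs <;> omega
    have hadm : ∀ p, M.faceApply (fun i j k => Admissible 3 (c i % 2) (c j % 2) (c k % 2) ∧
        Admissible (2 * ρ + 3) (2 * x i) (2 * x j) (2 * x k)) p := fun p => by
      have hp := (M.admissibleColoring_iff _ _).1 hc.2 p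
      dsimp only [faceApply] at hp ⊢
      rw [(hx _).2.2, (hx (M.edge _ (p.2.succAbove 0) (p.2.succAbove 2) _)).2.2,
        (hx (M.edge _ (p.2.succAbove 1) (p.2.succAbove 2) _)).2.2] at hp
      exact (admissible_recolor rfl (by omega) (by omega) (by omega) (hx _).1 (hx _).1
        (hx _).1).1 hp
    rw [Finset.mem_product, mem_admissibleColorings, mem_admissibleColorings]
    simp only [(hx _).2.1]
    refine ⟨⟨fun e => Finset.mem_range.2 (by omega),
      (M.admissibleColoring_iff _ _).2 fun p => (hadm p).1⟩,
      fun e => Finset.mem_filter.2 ⟨Finset.mem_range.2 ?_, even_two_mul _⟩,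
      (M.admissibleColoring_iff _ _).2 fun p => (hadm p).2⟩
    have := (hx e).1
    omega
  · rintro ⟨a, c⟩ hp
    rw [Finset.mem_product] at hp
    obtain ⟨ha1, ha⟩ := hmem3 hp.1
    obtain ⟨x, hx, rfl, hc⟩ := hmem' hp.2
    refine Prod.ext (funext fun e => ?_) (funext fun e => ?_) <;>
    · have := hx e
      have : a e ≤ 1 := ha1 e
      dsimp only [recolor]
      split_ifs <;> omega
  · intro c hc
    rw [mem_admissibleColorings] at hc
    funext e
    have := Finset.mem_range.1 (hc.1 e)
    dsimp only [recolor]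
    split_ifs <;> omega
  · rintro ⟨a, c⟩ hp
    rw [Finset.mem_product] at hp
    obtain ⟨ha1, ha⟩ := hmem3 hp.1
    obtain ⟨x, hx, rfl, hc⟩ := hmem' hp.2
    rw [M.weight_three h₃ ha ha1]
    exact (M.weight_recolor h rfl ha ha1 hc hx).symm

lemma turaevViro_eq_mul {r : ℕ} {A A₃ s : ℂ} (h : IsReflecting r A s)
    (h₃ : IsReflecting 3 A₃ s) (hr : 3 ≤ r) (hodd : Odd r) :
    M.turaevViro r A = M.turaevViro 3 A₃ * M.turaevViroSO3 r A := by
  rw [turaevViro, turaevViro, turaevViroSO3, M.stateSum_eq_mul h h₃ hr hodd, pow_mul, pow_mul,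
    pow_mul, eta_sq r, h₃.eta_three_sq, mul_pow]
  ring

end TriangulatedThreeManifold

namespace TriangulatedThreeManifold

open QuantumNumber TetGluing

variable {T : Type*} (M : TriangulatedThreeManifold T) [Fintype T]

lemma card_admissibleColorings_three :
    (M.admissibleColorings 3 (colors 3)).card = 2 ^ Module.finrank (ZMod 2) M.cocycles := by
  have hcard : Fintype.card (ZMod 2) = 2 := ZMod.card 2
  have : Fintype M.cocycles := Fintype.ofFinite _
  have h := Module.card_eq_pow_finrank (K := ZMod 2) (V := M.cocycles)
  rw [ZMod.card] at h
  rw [← h, ← Finset.card_univ]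
  have hmem : ∀ c, c ∈ M.admissibleColorings 3 (colors 3) ↔
      (∀ e, c e < 2) ∧ (fun e => (c e : ZMod 2)) ∈ M.cocycles := by
    intro c
    rw [mem_admissibleColorings, admissibleColoring_iff]
    simp only [colors, Finset.mem_range]
    refine and_congr_right fun hc => forall_congr' fun p => ?_
    dsimp only [faceApply]
    rw [← Nat.cast_add, ← Nat.cast_add, ZMod.natCast_eq_zero_iff_even]
    have h1 := hc (M.edge p.1 (p.2.succAbove 0) (p.2.succAbove 1)
      (p.2.succAbove_right_injective.ne (by decide)))
    have h2 := hc (M.edge p.1 (p.2.succAbove 0) (p.2.succAbove 2)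
      (p.2.succAbove_right_injective.ne (by decide)))
    have h3 := hc (M.edge p.1 (p.2.succAbove 1) (p.2.succAbove 2)
      (p.2.succAbove_right_injective.ne (by decide)))
    simp only [Admissible]
    refine ⟨fun h => h.2.1, fun h => ?_⟩
    obtain ⟨k, hk⟩ := h
    exact ⟨by omega, ⟨k, hk⟩, by omega⟩
  refine Finset.card_bij (fun c hc => ⟨fun e => (c e : ZMod 2), ((hmem c).1 hc).2⟩)
    (fun _ _ => Finset.mem_univ _) (fun c hc c' hc' heq => ?_) (fun a _ => ?_)
  · funext e
    have h1 : (c e : ZMod 2) = c' e := congrFun (congrArg Subtype.val heq) e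
    rw [ZMod.natCast_eq_natCast_iff'] at h1
    have h2 := ((hmem c).1 hc).1 e
    have h3 := ((hmem c').1 hc').1 e
    omega
  · have hv : (fun e => ((a.1 e).val : ZMod 2)) = a.1 := funext fun e => ZMod.natCast_zmod_val _
    exact ⟨fun e => (a.1 e).val, (hmem _).2 ⟨fun e => ZMod.val_lt _, by simpa only [hv] using a.2⟩,
      Subtype.ext hv⟩

lemma isReflecting_three : IsReflecting 3 (Complex.exp (Real.pi * Complex.I / 3)) (-1) := by
  refine isReflecting_two_mul (by decide) (by norm_num) ?_
  have := Complex.isPrimitiveRoot_exp 6 (by norm_num)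
  convert this using 2
  push_cast
  ring

/-- The value of the Turaev-Viro invariant at the sixth root of unity. -/
lemma turaevViro_three : M.turaevViro 3 (Complex.exp (Real.pi * Complex.I / 3)) =
    (2 : ℂ) ^ ((Module.finrank (ZMod 2) M.cocycles : ℤ) - (M.numVertices : ℤ)) := by
  have h := isReflecting_three
  have hw : ∀ c ∈ M.admissibleColorings 3 (colors 3),
      M.weight (Complex.exp (Real.pi * Complex.I / 3)) c = 1 := fun c hc => by
    rw [mem_admissibleColorings] at hc
    rw [M.weight_three h hc.2 fun e => by have := Finset.mem_range.1 (hc.1 e); omega]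
    simp [recolorSign]
  rw [turaevViro, stateSum_eq, Finset.sum_congr rfl hw, Finset.sum_const,
    card_admissibleColorings_three, pow_mul, h.eta_three_sq, zpow_sub₀ two_ne_zero]
  simp [mul_comm, div_eq_mul_inv]

end TriangulatedThreeManifold

namespace TetGluing

variable {T : Type*} (X : TetGluing T)

lemma rel_symm {p q : T × LocalCell} (h : X.Rel p q) : X.Rel q p := by
  obtain ⟨t, x⟩ := p
  obtain ⟨i, hi, rfl⟩ := h
  refine ⟨X.perm t i i, by simpa [LocalCell.map] using hi, Prod.ext ?_ ?_⟩
  · exact (X.adj_adj t i).symm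
  · change x = ((x.map _).map (X.perm (X.adj t i) (X.perm t i i)))
    rw [X.perm_adj, LocalCell.map_map_inv]

lemma rel_unique {p q q' : T × LocalCell} (hp : 3 ≤ p.2.2.card) (h : X.Rel p q)
    (h' : X.Rel p q') : q = q' := by
  obtain ⟨i, hi, rfl⟩ := h
  obtain ⟨i', hi', rfl⟩ := h'
  obtain rfl : i = i' := by
    by_contra hne
    have h1 : ({i, i'} : Finset (Fin 4)) ⊆ p.2.2ᶜ := by
      intro a ha
      rcases Finset.mem_insert.1 ha with rfl | ha
      · exact Finset.mem_compl.2 hi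
      · rw [Finset.mem_singleton.1 ha]; exact Finset.mem_compl.2 hi'
    have h2 := Finset.card_le_card h1
    rw [Finset.card_pair hne, Finset.card_compl, Fintype.card_fin] at h2
    omega
  rfl

lemma rel_card {p q : T × LocalCell} (h : X.Rel p q) : q.2.2.card = p.2.2.card := by
  obtain ⟨i, hi, rfl⟩ := h
  simp [LocalCell.map]

lemma cell_eq_iff_eqvGen {t t' : T} {x x' : LocalCell} :
    X.cell t x = X.cell t' x' ↔ Relation.EqvGen X.Rel (t, x) (t', x') := Quot.eq

lemma isNone_eq_of_cell_eq {t t' : T} {x x' : LocalCell} (h : X.cell t x = X.cell t' x') :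
    x.1.isNone = x'.1.isNone :=
  congrArg (Quot.lift (fun p : T × LocalCell => p.2.1.isNone) fun p _ h => by
    obtain ⟨i, hi, rfl⟩ := h
    simp [LocalCell.map]) h

/-- The cell of the gluing that contains a cell of a truncation triangle. -/
lemma cell_none_eq_of_cell_eq {t t' : T} {x x' : LocalCell} (h : X.cell t x = X.cell t' x') :
    X.cell t (none, x.2) = X.cell t' (none, x'.2) :=
  congrArg (Quot.map (fun p : T × LocalCell => (p.1, ((none, p.2.2) : LocalCell)))
    fun p _ h => by
      obtain ⟨i, hi, rfl⟩ := h
      exact ⟨i, hi, by simp [LocalCell.map]⟩) h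

/-- Only the cells in the interior of a face are identified with exactly one other cell, and
the cells of dimension three and their truncation triangles with none. -/
lemma eq_or_rel_of_cell_eq {t t' : T} {x x' : LocalCell} (hx : 3 ≤ x.2.card)
    (h : X.cell t x = X.cell t' x') : (t, x) = (t', x') ∨ X.Rel (t, x) (t', x') := by
  have key : ∀ p q, Relation.EqvGen X.Rel p q →
      p.2.2.card = q.2.2.card ∧ (3 ≤ p.2.2.card → p = q ∨ X.Rel p q) := by
    intro p q hpq
    induction hpq with
    | rel a b hab => exact ⟨(X.rel_card hab).symm, fun _ => .inr hab⟩
    | refl a => exact ⟨rfl, fun _ => .inl rfl⟩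
    | symm a b _ ih =>
      exact ⟨ih.1.symm, fun h => (ih.2 (ih.1 ▸ h)).imp Eq.symm X.rel_symm⟩
    | trans a b c _ _ h1 h2 =>
      refine ⟨h1.1.trans h2.1, fun h => ?_⟩
      rcases h1.2 h with rfl | hab
      · exact h2.2 h
      · rcases h2.2 (h1.1 ▸ h) with rfl | hbc
        · exact .inr hab
        · exact .inl (X.rel_unique (h1.1 ▸ h) (X.rel_symm hab) hbc)
  exact (key _ _ (X.cell_eq_iff_eqvGen.1 h)).2 hx

lemma cell_univ_eq_iff {t t' : T} {v v' : Option (Fin 4)} :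
    X.cell t (v, Finset.univ) = X.cell t' (v', Finset.univ) ↔ t = t' ∧ v = v' := by
  refine ⟨fun h => ?_, by rintro ⟨rfl, rfl⟩; rfl⟩
  rcases X.eq_or_rel_of_cell_eq (by simp) h with h | ⟨i, hi, -⟩
  · simpa using h
  · simp at hi

lemma cell_compl_eq_iff {t t' : T} {v v' : Option (Fin 4)} {i i' : Fin 4} :
    X.cell t (v, {i}ᶜ) = X.cell t' (v', {i'}ᶜ) ↔ ((t, i) = (t', i') ∧ v = v') ∨
      ((t', i') = X.glue (t, i) ∧ v' = v.map (X.perm t i)) := by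
  have hmap : ({i}ᶜ : Finset (Fin 4)).map (X.perm t i).toEmbedding = {X.perm t i i}ᶜ := by
    ext a
    simp only [Finset.mem_map, Finset.mem_compl, Finset.mem_singleton, Equiv.coe_toEmbedding]
    refine ⟨?_, fun h => ⟨(X.perm t i).symm a, fun h' => h ?_, by simp⟩⟩
    · rintro ⟨b, hb, rfl⟩ h
      exact hb ((X.perm t i).injective h)
    · exact (Equiv.symm_apply_eq _).1 h'
  constructor
  · intro h
    rcases X.eq_or_rel_of_cell_eq (by rw [Finset.card_compl]; simp) h with h | ⟨j, hj, h⟩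
    · left; simpa [and_assoc, and_comm] using h
    · right
      obtain rfl : j = i := by simpa using hj
      dsimp only at h
      simp only [LocalCell.map, hmap, Prod.mk.injEq, compl_inj_iff, Finset.singleton_inj] at h
      exact ⟨Prod.ext h.1 h.2.2, h.2.1⟩
  · rintro (⟨h, rfl⟩ | ⟨h, rfl⟩)
    · obtain ⟨rfl, rfl⟩ := Prod.mk.injEq .. ▸ h
      rfl
    · obtain ⟨rfl, rfl⟩ := Prod.mk.injEq .. ▸ h
      refine Quot.sound ⟨i, by simp, ?_⟩
      simp [LocalCell.map, hmap]

/-- Identified cells are identified by a permutation of the vertices that also identifies the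
corresponding cells of the truncation triangles. -/
lemma exists_perm_of_cell_eq {t t' : T} {x x' : LocalCell} (h : X.cell t x = X.cell t' x') :
    ∃ ρ : Equiv.Perm (Fin 4), x' = x.map ρ ∧
      ∀ v, X.cell t (v, x.2) = X.cell t' (v.map ρ, x'.2) := by
  have key : ∀ p q, Relation.EqvGen X.Rel p q → ∃ ρ : Equiv.Perm (Fin 4), q.2 = p.2.map ρ ∧
      ∀ v, X.cell p.1 (v, p.2.2) = X.cell q.1 (v.map ρ, q.2.2) := by
    intro p q hpq
    induction hpq with
    | rel a b hab =>
      obtain ⟨i, hi, rfl⟩ := hab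
      exact ⟨X.perm a.1 i, rfl, fun v => Quot.sound ⟨i, hi, rfl⟩⟩
    | refl a => exact ⟨1, Prod.ext (by simp [LocalCell.map])
        (by ext; simp [LocalCell.map]; rfl), fun v => by simp⟩
    | symm a b _ ih =>
      obtain ⟨ρ, h1, h2⟩ := ih
      refine ⟨ρ⁻¹, by rw [h1, LocalCell.map_map_inv], fun v => ?_⟩
      rw [h2]
      simp
    | trans a b c _ _ h1 h2 =>
      obtain ⟨ρ, h1, h1'⟩ := h1
      obtain ⟨ρ', h2, h2'⟩ := h2
      refine ⟨ρ' * ρ, ?_, fun v => ?_⟩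
      · rw [h2, h1]
        simp [LocalCell.map, Finset.map_map]
        rfl
      · rw [h1', h2']
        simp
  exact key _ _ (X.cell_eq_iff_eqvGen.1 h)

/-- A symmetric function of the edges of the tetrahedra that is compatible with the gluing
descends to the edges of the gluing. -/
lemma eq_of_edge_eq {β : Type*} {g : T → Fin 4 → Fin 4 → β} (hg : ∀ t j k, g t j k = g t k j)
    (hg' : ∀ t i j k, i ≠ j → i ≠ k →
      g (X.adj t i) (X.perm t i j) (X.perm t i k) = g t j k) {t t' : T} {j k j' k' : Fin 4}
    {h : j ≠ k} {h' : j' ≠ k'} (heq : X.edge t j k h = X.edge t' j' k' h') :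
    g t j k = g t' j' k' := by
  have hrel : ∀ {p q}, X.Rel p q → ∀ b, (∃ j k, j ≠ k ∧ p.2.2 = {j, k} ∧ g p.1 j k = b) →
      ∃ j k, j ≠ k ∧ q.2.2 = {j, k} ∧ g q.1 j k = b := by
    rintro ⟨t, v, s⟩ q ⟨i, hi, rfl⟩ b ⟨j, k, hjk, hs, rfl⟩
    dsimp only at hs hi
    subst hs
    simp only [Finset.mem_insert, Finset.mem_singleton, not_or] at hi
    exact ⟨X.perm t i j, X.perm t i k, (X.perm t i).injective.ne hjk, by simp [LocalCell.map],
      hg' t i j k hi.1 hi.2⟩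
  let S : X.Cell → Set β := Quot.lift
    (fun p => {b | ∃ j k, j ≠ k ∧ p.2.2 = {j, k} ∧ g p.1 j k = b})
    fun p q hpq => Set.ext fun b => ⟨hrel hpq b, hrel (X.rel_symm hpq) b⟩
  have hmem : g t j k ∈ S (X.edge t' j' k' h').1 := by
    rw [← heq]
    exact ⟨j, k, h, rfl, rfl⟩
  obtain ⟨a, b, hab, hs, hb⟩ := hmem
  have hs' : ({j', k'} : Set (Fin 4)) = {a, b} := by
    have := congrArg (fun s : Finset (Fin 4) => (s : Set (Fin 4))) hs
    simpa using this
  rw [← hb]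
  rcases Set.pair_eq_pair_iff.1 hs' with ⟨rfl, rfl⟩ | ⟨rfl, rfl⟩
  · rfl
  · exact hg _ _ _

/-- A tetrahedron and two of its vertices that represent the given edge. -/
lemma exists_edge_eq (e : X.Edge) : ∃ p : T × Fin 4 × Fin 4, ∃ h : p.2.1 ≠ p.2.2,
    e = X.edge p.1 p.2.1 p.2.2 h := by
  obtain ⟨x, t, j, k, h, rfl⟩ := e
  exact ⟨(t, j, k), h, rfl⟩

end TetGluing

namespace TetGluing.LocalCell

instance (b : Bool) (x : LocalCell) : Decidable (IsCell b x) :=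
  match b with
  | false => inferInstanceAs (Decidable (x.1 = none ∧ x.2.Nonempty))
  | true => inferInstanceAs (Decidable (2 ≤ x.2.card ∧ ∀ j, x.1 = some j → j ∈ x.2))

instance (b : Bool) (y x : LocalCell) : Decidable (IsFacet b y x) :=
  inferInstanceAs (Decidable (IsCell b y ∧ y.2 ⊆ x.2 ∧ (x.1 = none ∨ y.1 = x.1) ∧
    y.dim + 1 = x.dim))

/-- The facets of a cell. -/
def facets (b : Bool) (x : LocalCell) : Finset LocalCell :=
  Finset.univ.filter fun z => IsFacet b z x

lemma facets_edge : ∀ j k : Fin 4, j ≠ k →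
    facets false (none, {j, k}) = {(none, {j}), (none, {k})} := by
  decide +kernel

lemma facets_face_false : ∀ i : Fin 4, facets false (none, {i}ᶜ) =
    {(none, {i.succAbove 0, i.succAbove 1}), (none, {i.succAbove 0, i.succAbove 2}),
      (none, {i.succAbove 1, i.succAbove 2})} := by
  decide +kernel

lemma facets_face_true : ∀ i : Fin 4, facets true (none, {i}ᶜ) =
    {(none, {i.succAbove 0, i.succAbove 1}), (none, {i.succAbove 0, i.succAbove 2}),
      (none, {i.succAbove 1, i.succAbove 2})} ∪
      ({i}ᶜ : Finset (Fin 4)).image fun j => (some j, {i}ᶜ) := by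
  decide +kernel

lemma facets_triangle : ∀ j : Fin 4, facets true (some j, Finset.univ) =
    ({j}ᶜ : Finset (Fin 4)).image fun i => (some j, {i}ᶜ) := by
  decide +kernel

lemma facets_univ_false : facets false (none, Finset.univ) =
    Finset.univ.image fun i => (none, {i}ᶜ) := by
  decide +kernel

lemma facets_univ_true : facets true (none, Finset.univ) =
    (Finset.univ.image fun i => (none, {i}ᶜ)) ∪
      Finset.univ.image fun j => (some j, Finset.univ) := by
  decide +kernel

variable {β : Type*} [AddCommMonoid β]

lemma sum_three_edges (i : Fin 4) (φ : LocalCell → β) :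
    ∑ z ∈ {(none, {i.succAbove 0, i.succAbove 1}), (none, {i.succAbove 0, i.succAbove 2}),
      (none, {i.succAbove 1, i.succAbove 2})}, φ z =
      φ (none, {i.succAbove 0, i.succAbove 1}) + φ (none, {i.succAbove 0, i.succAbove 2}) +
        φ (none, {i.succAbove 1, i.succAbove 2}) := by
  have h1 : ∀ i : Fin 4, ((none, {i.succAbove 0, i.succAbove 1}) : LocalCell) ∉
      ({(none, {i.succAbove 0, i.succAbove 2}),
        (none, {i.succAbove 1, i.succAbove 2})} : Finset LocalCell) := by decide
  have h2 : ∀ i : Fin 4, ((none, {i.succAbove 0, i.succAbove 2}) : LocalCell) ∉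
      ({(none, {i.succAbove 1, i.succAbove 2})} : Finset LocalCell) := by decide
  rw [Finset.sum_insert (h1 i), Finset.sum_insert (h2 i), Finset.sum_singleton, add_assoc]

lemma sum_facets_edge {j k : Fin 4} (h : j ≠ k) (φ : LocalCell → β) :
    ∑ z ∈ facets false (none, {j, k}), φ z = φ (none, {j}) + φ (none, {k}) := by
  rw [facets_edge j k h, Finset.sum_pair (by simpa using h)]

lemma sum_facets_face_false (i : Fin 4) (φ : LocalCell → β) :
    ∑ z ∈ facets false (none, {i}ᶜ), φ z =
      φ (none, {i.succAbove 0, i.succAbove 1}) + φ (none, {i.succAbove 0, i.succAbove 2}) +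
        φ (none, {i.succAbove 1, i.succAbove 2}) := by
  rw [facets_face_false, sum_three_edges]

lemma sum_facets_face_true (i : Fin 4) (φ : LocalCell → β) :
    ∑ z ∈ facets true (none, {i}ᶜ), φ z =
      φ (none, {i.succAbove 0, i.succAbove 1}) + φ (none, {i.succAbove 0, i.succAbove 2}) +
        φ (none, {i.succAbove 1, i.succAbove 2}) + ∑ j ∈ {i}ᶜ, φ (some j, {i}ᶜ) := by
  rw [facets_face_true, Finset.sum_union, sum_three_edges, Finset.sum_image]
  · intro a _ b _ h
    simpa using h
  · rw [Finset.disjoint_left]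
    intro z hz hz'
    obtain ⟨j, -, rfl⟩ := Finset.mem_image.1 hz'
    simp at hz

lemma sum_facets_triangle (j : Fin 4) (φ : LocalCell → β) :
    ∑ z ∈ facets true (some j, Finset.univ), φ z = ∑ i ∈ {j}ᶜ, φ (some j, {i}ᶜ) := by
  rw [facets_triangle, Finset.sum_image]
  intro a _ b _ h
  simpa using h

lemma sum_facets_univ_false (φ : LocalCell → β) :
    ∑ z ∈ facets false (none, Finset.univ), φ z = ∑ i, φ (none, {i}ᶜ) := by
  rw [facets_univ_false, Finset.sum_image]
  intro a _ b _ h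
  simpa using h

lemma sum_facets_univ_true (φ : LocalCell → β) :
    ∑ z ∈ facets true (none, Finset.univ), φ z =
      ∑ i, φ (none, {i}ᶜ) + ∑ j, φ (some j, Finset.univ) := by
  rw [facets_univ_true, Finset.sum_union, Finset.sum_image, Finset.sum_image]
  · intro a _ b _ h
    simpa using h
  · intro a _ b _ h
    simpa using h
  · rw [Finset.disjoint_left]
    intro z hz hz'
    obtain ⟨j, -, rfl⟩ := Finset.mem_image.1 hz'
    simp at hz

end TetGluing.LocalCell

namespace TriangulatedThreeManifold

open TetGluing

variable {T : Type*} (M : TriangulatedThreeManifold T)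

lemma incidence_cell (t : T) (x : LocalCell) (y : M.Cell) : M.incidence (M.cell t x) y =
    (Nat.card {z : LocalCell // LocalCell.IsFacet M.ideal z x ∧ M.cell t z = y} : ZMod 2) := rfl

/-! ### Cells of dimension two and three -/

/-- The cell of dimension three that is the given tetrahedron. -/
def tetCell (t : T) : M.NCell 3 :=
  ⟨M.cell t (none, Finset.univ), t, (none, Finset.univ), by cases M.ideal <;> decide, by decide, rfl⟩

/-- The cell of dimension two that is the given face. -/
def faceCell (p : T × Fin 4) : M.NCell 2 :=
  ⟨M.cell p.1 (none, {p.2}ᶜ), p.1, (none, {p.2}ᶜ), by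
    cases M.ideal <;> generalize p.2 = i <;> revert i <;> decide, by
    generalize p.2 = i; revert i; decide, rfl⟩

lemma tetCell_bijective : Function.Bijective M.tetCell := by
  refine ⟨fun t t' h => ((M.cell_univ_eq_iff).1 (congrArg Subtype.val h)).1, ?_⟩
  rintro ⟨x, t, ⟨v, s⟩, h, hd, rfl⟩
  refine ⟨t, Subtype.ext ?_⟩
  have key : ∀ b v s, LocalCell.IsCell b (v, s) → LocalCell.dim (v, s) = 3 →
      v = none ∧ s = Finset.univ := by
    decide +kernel
  obtain ⟨rfl, rfl⟩ := key _ _ _ h hd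
  rfl

lemma faceCell_eq_iff (p q : T × Fin 4) : M.faceCell p = M.faceCell q ↔ M.face p = M.face q := by
  rw [M.face_eq_iff]
  refine Subtype.ext_iff.trans (M.cell_compl_eq_iff.trans ?_)
  simp only [and_true, Option.map_none]
  refine or_congr Iff.rfl ⟨fun h => ?_, fun h => ?_⟩
  · change q = M.glue p at h
    rw [h, glue_glue]
  · change q = M.glue p
    rw [h, glue_glue]

lemma exists_extension {n : ℕ} (φ : M.NCell n → ZMod 2) :
    ∃ ψ : M.Cell → ZMod 2, φ = fun y => ψ y.1 := by
  refine ⟨Function.extend Subtype.val φ 0, funext fun y => ?_⟩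
  exact (Subtype.val_injective.extend_apply φ 0 y).symm

variable [Fintype T]

/-- The sum of the values of a cochain on the facets of a cell. -/
def coboundary (φ : M.Cell → ZMod 2) (x : M.Cell) : ZMod 2 :=
  ∑ y : M.Cell, M.incidence x y * φ y

lemma coboundary_cell (φ : M.Cell → ZMod 2) (t : T) (x : LocalCell) :
    M.coboundary φ (M.cell t x) = ∑ z ∈ LocalCell.facets M.ideal x, φ (M.cell t z) := by
  classical
  have h : ∀ y, M.incidence (M.cell t x) y * φ y =
      ∑ z ∈ LocalCell.facets M.ideal x, if M.cell t z = y then φ (M.cell t z) else 0 := by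
    intro y
    rw [incidence_cell, Nat.card_eq_fintype_card, Fintype.card_subtype, ← Finset.filter_filter,
      ← Finset.sum_filter, LocalCell.facets, Finset.sum_congr rfl fun z hz => by
        rw [(Finset.mem_filter.1 hz).2], Finset.sum_const, nsmul_eq_mul]
  simp only [coboundary, h]
  rw [Finset.sum_comm]
  exact Finset.sum_congr rfl fun z _ => by simp

lemma boundaryMap_apply (n : ℕ) (u : M.NCell (n + 1) → ZMod 2) (y : M.NCell n) :
    M.boundaryMap n u y = ∑ x, M.incidence x.1 y.1 * u x := rfl

lemma sum_incidence_mul {n : ℕ} (φ : M.Cell → ZMod 2) (x : M.NCell (n + 1)) :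
    ∑ y : M.NCell n, M.incidence x.1 y.1 * φ y.1 = M.coboundary φ x.1 := by
  refine Finset.sum_of_injOn Subtype.val Subtype.val_injective.injOn
    (fun _ _ => Finset.mem_coe.2 (Finset.mem_univ _)) (fun y _ hy => ?_) fun _ _ => rfl
  obtain ⟨x, t, z, hz, hdim, rfl⟩ := x
  rw [incidence_cell]
  have : IsEmpty {w : LocalCell // LocalCell.IsFacet M.ideal w z ∧ M.cell t w = y} := by
    refine ⟨fun ⟨w, hw, hwy⟩ => hy ⟨⟨y, t, w, hw.1, ?_, hwy.symm⟩,
      Finset.mem_coe.2 (Finset.mem_univ _), rfl⟩⟩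
    have := hw.2.2.2
    omega
  simp

/-- The boundary map is adjoint to the coboundary. -/
lemma sum_boundaryMap_mul {n : ℕ} (u : M.NCell (n + 1) → ZMod 2) (φ : M.Cell → ZMod 2) :
    ∑ y, M.boundaryMap n u y * φ y.1 = ∑ x, u x * M.coboundary φ x.1 := by
  simp only [boundaryMap_apply, Finset.sum_mul, ← sum_incidence_mul, Finset.mul_sum]
  rw [Finset.sum_comm]
  exact Finset.sum_congr rfl fun x _ => Finset.sum_congr rfl fun y _ => by ring

open Classical in
lemma boundaryMap_eq_sum (n : ℕ) (u : M.NCell (n + 1) → ZMod 2) (y : M.NCell n) :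
    M.boundaryMap n u y = ∑ x, u x * M.coboundary (Pi.single y.1 1) x.1 := by
  rw [← sum_boundaryMap_mul, Finset.sum_eq_single y]
  · simp
  · intro z _ hz
    rw [Pi.single_eq_of_ne fun h => hz (Subtype.ext h), mul_zero]
  · simp

/-- The restriction of the coboundary to the cochains of degree `n`. -/
def coboundaryMap (n : ℕ) : (M.NCell n → ZMod 2) →ₗ[ZMod 2] (M.NCell (n + 1) → ZMod 2) :=
  Matrix.mulVecLin (Matrix.of fun (x : M.NCell (n + 1)) (y : M.NCell n) => M.incidence x.1 y.1)

lemma coboundaryMap_apply {n : ℕ} (φ : M.Cell → ZMod 2) (x : M.NCell (n + 1)) :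
    M.coboundaryMap n (fun y => φ y.1) x = M.coboundary φ x.1 := M.sum_incidence_mul φ x

lemma finrank_range_add_finrank_ker (n : ℕ) :
    Module.finrank (ZMod 2) (LinearMap.range (M.boundaryMap n)) +
      Module.finrank (ZMod 2) (LinearMap.ker (M.coboundaryMap n)) = Fintype.card (M.NCell n) := by
  have h := (M.coboundaryMap n).finrank_range_add_finrank_ker
  have ht := Matrix.rank_transpose
    (Matrix.of fun (y : M.NCell n) (x : M.NCell (n + 1)) => M.incidence x.1 y.1)
  rw [Module.finrank_fintype_fun_eq_card] at h
  rw [← h]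
  congr 1
  exact ht.symm

lemma sum_tetCell (h : M.NCell 3 → ZMod 2) : ∑ x, h x = ∑ t, h (M.tetCell t) :=
  (Function.Bijective.sum_comp M.tetCell_bijective h).symm

end TriangulatedThreeManifold

namespace TriangulatedThreeManifold

open TetGluing

variable {T : Type*} {M : TriangulatedThreeManifold T} (hM : M.ideal = true)

/-- The cell of dimension two that is the truncation triangle at the vertex `p.2` of the
tetrahedron `p.1`. -/
def triangleCell (p : T × Fin 4) : M.NCell 2 :=
  ⟨M.cell p.1 (some p.2, Finset.univ), p.1, (some p.2, Finset.univ), by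
    rw [hM]; generalize p.2 = i; revert i; decide, by
    generalize p.2 = i; revert i; decide, rfl⟩

lemma twoCells_bijective : Function.Bijective
    (Sum.elim (fun f : M.Face => M.faceCell (Quot.out f)) (triangleCell hM)) := by
  constructor
  · rintro (f | p) (f' | p') h
    · have := (M.faceCell_eq_iff _ _).1 h
      rw [M.face_out, M.face_out] at this
      rw [this]
    · simpa using M.isNone_eq_of_cell_eq (congrArg Subtype.val h)
    · simpa using M.isNone_eq_of_cell_eq (congrArg Subtype.val h)
    · obtain ⟨h1, h2⟩ := M.cell_univ_eq_iff.1 (congrArg Subtype.val h)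
      rw [Prod.ext h1 (Option.some_injective _ h2)]
  · rintro ⟨x, t, ⟨v, s⟩, h, hd, rfl⟩
    have key : ∀ v s, LocalCell.IsCell true (v, s) → LocalCell.dim (v, s) = 2 →
        (v = none ∧ ∃ i, s = {i}ᶜ) ∨ (∃ j, v = some j) ∧ s = Finset.univ := by
      decide +kernel
    rw [hM] at h
    rcases key _ _ h hd with ⟨rfl, i, rfl⟩ | ⟨⟨j, rfl⟩, rfl⟩
    · refine ⟨Sum.inl (M.face (t, i)), ?_⟩
      have : M.faceCell (Quot.out (M.face (t, i))) = M.faceCell (t, i) :=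
        (M.faceCell_eq_iff _ _).2 (M.face_out _)
      exact this
    · exact ⟨Sum.inr (t, j), rfl⟩

lemma faceCell_glue (p : T × Fin 4) : M.faceCell (M.glue p) = M.faceCell p :=
  (M.faceCell_eq_iff _ _).2 (M.face_glue p)

lemma eq_out_or_eq_glue_out (p : T × Fin 4) :
    p = Quot.out (M.face p) ∨ p = M.glue (Quot.out (M.face p)) :=
  (M.face_eq_iff _ _).1 (M.face_out _).symm

/-- The equation that a chain of degree two satisfies on the side of a truncation triangle if it
is a cycle. -/
def sideSum (u : M.NCell 2 → ZMod 2) (p : T × Fin 4) (j : Fin 4) : ZMod 2 :=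
  u (M.faceCell p) + u (triangleCell hM (p.1, j)) +
    u (triangleCell hM (M.adj p.1 p.2, M.perm p.1 p.2 j))

lemma sideSum_glue (u : M.NCell 2 → ZMod 2) (p : T × Fin 4) (j : Fin 4) :
    sideSum hM u (M.glue p) (M.perm p.1 p.2 j) = sideSum hM u p j := by
  rw [sideSum, sideSum, faceCell_glue]
  dsimp only [glue]
  rw [M.adj_adj, M.perm_adj, Equiv.Perm.inv_def, Equiv.symm_apply_apply]
  ring

variable [Fintype T]

lemma sum_twoCells (h : M.NCell 2 → ZMod 2) : ∑ x, h x =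
    ∑ f : M.Face, h (M.faceCell (Quot.out f)) + ∑ p, h (triangleCell hM p) := by
  rw [← (twoCells_bijective hM).sum_comp h, Fintype.sum_sum_type]
  rfl

lemma sum_boundary_mul_ideal (u : M.NCell 2 → ZMod 2) (φ : M.Cell → ZMod 2) :
    ∑ y, M.boundaryMap 1 u y * φ y.1 = ∑ f : M.Face, (u (M.faceCell (Quot.out f)) *
      M.faceApply (fun a b c => φ a.1 + φ b.1 + φ c.1) (Quot.out f) +
      ∑ j ∈ {(Quot.out f).2}ᶜ, sideSum hM u (Quot.out f) j *
        φ (M.cell (Quot.out f).1 (some j, {(Quot.out f).2}ᶜ))) := by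
  rw [sum_boundaryMap_mul, sum_twoCells hM]
  have hface : ∀ p, M.coboundary φ (M.faceCell p).1 =
      M.faceApply (fun a b c => φ a.1 + φ b.1 + φ c.1) p +
        ∑ j ∈ {p.2}ᶜ, φ (M.cell p.1 (some j, {p.2}ᶜ)) := fun p => by
    rw [faceCell, coboundary_cell, hM, LocalCell.sum_facets_face_true]
    rfl
  have htri : ∀ p, M.coboundary φ (triangleCell hM p).1 =
      ∑ i ∈ {p.2}ᶜ, φ (M.cell p.1 (some p.2, {i}ᶜ)) := fun p => by
    rw [triangleCell, coboundary_cell, hM, LocalCell.sum_facets_triangle]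
  let S : T × Fin 4 → ZMod 2 := fun p => ∑ j ∈ {p.2}ᶜ,
    u (triangleCell hM (p.1, j)) * φ (M.cell p.1 (some j, {p.2}ᶜ))
  have hS : ∑ p, u (triangleCell hM p) * M.coboundary φ (triangleCell hM p).1 = ∑ p, S p := by
    rw [Fintype.sum_prod_type, Fintype.sum_prod_type]
    refine Finset.sum_congr rfl fun t _ => ?_
    simp only [htri, S, Finset.mul_sum]
    exact Finset.sum_comm' fun i j => by simp [eq_comm]
  have hS' : ∀ p, S (M.glue p) = ∑ j ∈ {p.2}ᶜ,
      u (triangleCell hM (M.adj p.1 p.2, M.perm p.1 p.2 j)) *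
        φ (M.cell p.1 (some j, {p.2}ᶜ)) := by
    rintro ⟨t, i⟩
    refine (Finset.sum_equiv (M.perm t i) (fun j => by simp [glue]) fun j _ => ?_).symm
    dsimp only [glue]
    congr 2
    exact M.cell_compl_eq_iff.2 (.inr ⟨rfl, rfl⟩)
  rw [hS, M.sum_faces, ← Finset.sum_add_distrib]
  refine Finset.sum_congr rfl fun f _ => ?_
  rw [hS', hface]
  simp only [S, sideSum, add_mul, Finset.sum_add_distrib, mul_add, Finset.mul_sum]
  ring

lemma sideSum_eq_zero {u : M.NCell 2 → ZMod 2} (hu : M.boundaryMap 1 u = 0) (p : T × Fin 4)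
    {j : Fin 4} (hj : j ≠ p.2) : sideSum hM u p j = 0 := by
  classical
  have key : ∀ (f : M.Face) (j : Fin 4), j ≠ (Quot.out f).2 →
      sideSum hM u (Quot.out f) j = 0 := by
    intro f j hj
    have h := sum_boundary_mul_ideal hM u
      (Pi.single (M.cell (Quot.out f).1 (some j, {(Quot.out f).2}ᶜ)) 1)
    have hcell : ∀ (f' : M.Face) (j' : Fin 4),
        M.cell (Quot.out f').1 (some j', {(Quot.out f').2}ᶜ) =
          M.cell (Quot.out f).1 (some j, {(Quot.out f).2}ᶜ) → f' = f ∧ j' = j := by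
      intro f' j' heq
      rcases M.cell_compl_eq_iff.1 heq with ⟨h1, h2⟩ | ⟨h1, h2⟩
      · have h1' : Quot.out f' = Quot.out f := h1
        refine ⟨?_, Option.some_injective _ h2⟩
        rw [← M.face_out f', h1', M.face_out]
      · have h1' : Quot.out f = M.glue (Quot.out f') := h1
        have h3 : f = f' := by rw [← M.face_out f, h1', M.face_glue, M.face_out]
        subst h3
        exact absurd h1'.symm (M.glue_ne _)
    have hedge : ∀ e : M.Edge, (Pi.single (M.cell (Quot.out f).1
        (some j, {(Quot.out f).2}ᶜ)) 1 : M.Cell → ZMod 2) e.1 = 0 := by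
      rintro ⟨x, t, a, b, hab, rfl⟩
      refine Pi.single_eq_of_ne (fun h => ?_) _
      simpa using M.isNone_eq_of_cell_eq h
    rw [hu, Finset.sum_eq_single f, Finset.sum_eq_single j] at h
    · simpa [faceApply, hedge] using h.symm
    · intro j' _ hj'
      rw [Pi.single_eq_of_ne (fun h => hj' (hcell f j' h).2), mul_zero]
    · intro h'
      simp [hj] at h'
    · intro f' _ hf'
      simp only [faceApply, hedge, add_zero, mul_zero, zero_add]
      refine Finset.sum_eq_zero fun j' _ => ?_
      rw [Pi.single_eq_of_ne (fun h => hf' (hcell f' j' h).1), mul_zero]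
    · simp
  rcases M.eq_out_or_eq_glue_out p with hp | hp
  · rw [hp] at hj ⊢
    exact key _ _ hj
  · obtain ⟨q, hq⟩ : ∃ q, q = Quot.out (M.face p) := ⟨_, rfl⟩
    rw [← hq] at hp
    obtain ⟨j, rfl⟩ := (M.perm q.1 q.2).surjective j
    have h := key (M.face p) j
    rw [← hq] at h
    rw [hp, sideSum_glue]
    exact h fun h' => hj (by rw [h', hp]; rfl)

end TriangulatedThreeManifold

namespace TriangulatedThreeManifold

open TetGluing

variable {T : Type*} {M : TriangulatedThreeManifold T} (hM : M.ideal = true)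

lemma faceCell_ne_triangleCell (p q : T × Fin 4) :
    (M.faceCell p).1 ≠ (triangleCell hM q).1 := fun h => by
  simpa using M.isNone_eq_of_cell_eq h

/-- The sum of the values of a chain of degree two on the truncation triangles at the ends of an
edge, the edge being considered in one of the tetrahedra that contain it. -/
def endSum : (M.NCell 2 → ZMod 2) →ₗ[ZMod 2] (M.Edge → ZMod 2) where
  toFun u e := u (triangleCell hM ((M.exists_edge_eq e).choose.1,
      (M.exists_edge_eq e).choose.2.1)) +
    u (triangleCell hM ((M.exists_edge_eq e).choose.1, (M.exists_edge_eq e).choose.2.2))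
  map_add' u v := funext fun e => by simp only [Pi.add_apply]; ring
  map_smul' r u := funext fun e => by
    simp only [Pi.smul_apply, smul_eq_mul, RingHom.id_apply]; ring

lemma endSum_edge {u : M.NCell 2 → ZMod 2} (hu : ∀ p j, j ≠ p.2 → sideSum hM u p j = 0) (t : T)
    {j k : Fin 4} (h : j ≠ k) : endSum hM u (M.edge t j k h) =
      u (triangleCell hM (t, j)) + u (triangleCell hM (t, k)) := by
  obtain ⟨hne, heq⟩ := (M.exists_edge_eq (M.edge t j k h)).choose_spec
  refine (M.eq_of_edge_eq (g := fun t j k => u (triangleCell hM (t, j)) +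
    u (triangleCell hM (t, k))) (fun t j k => add_comm _ _) (fun t i j k hj hk => ?_) heq).symm
  have h1 := hu (t, i) j hj.symm
  have h2 := hu (t, i) k hk.symm
  simp only [sideSum] at h1 h2
  have h3 := CharTwo.add_eq_zero.1 h1
  have h4 := CharTwo.add_eq_zero.1 h2
  rw [← h3, ← h4, add_add_add_comm, CharTwo.add_self_eq_zero, zero_add]

lemma endSum_mem_cocycles {u : M.NCell 2 → ZMod 2}
    (hu : ∀ p j, j ≠ p.2 → sideSum hM u p j = 0) : endSum hM u ∈ M.cocycles := by
  intro p
  simp only [faceApply, endSum_edge hM hu]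
  generalize u (triangleCell hM (p.1, p.2.succAbove 0)) = a
  generalize u (triangleCell hM (p.1, p.2.succAbove 1)) = b
  generalize u (triangleCell hM (p.1, p.2.succAbove 2)) = c
  revert a b c
  decide

lemma ext_twoCells {u v : M.NCell 2 → ZMod 2} (h1 : ∀ p, u (M.faceCell p) = v (M.faceCell p))
    (h2 : ∀ p, u (triangleCell hM p) = v (triangleCell hM p)) : u = v := by
  funext x
  obtain ⟨f | p, rfl⟩ := (twoCells_bijective hM).2 x
  · exact h1 _
  · exact h2 p

/-- A cocycle is the coboundary of a function on the vertices of each tetrahedron; these functions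
are extended to a chain of degree two that satisfies the equations on the sides. -/
lemma exists_chain_of_mem_cocycles {c : M.Edge → ZMod 2} (hc : c ∈ M.cocycles) :
    ∃ u : M.NCell 2 → ZMod 2, (∀ p j, j ≠ p.2 → sideSum hM u p j = 0) ∧
      ∀ t j, u (triangleCell hM (t, j)) = M.edgeVal c t 0 j := by
  have hτ := edgeVal_zero_add_edgeVal_zero hc
  let F : T × Fin 4 → Fin 4 → ZMod 2 := fun p j =>
    M.edgeVal c p.1 0 j + M.edgeVal c (M.adj p.1 p.2) 0 (M.perm p.1 p.2 j)
  have hF : ∀ p j k, j ≠ p.2 → k ≠ p.2 → F p j = F p k := by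
    intro p j k hj hk
    rw [← CharTwo.add_eq_zero]
    have h1 := hτ p.1 j k
    have h2 := hτ (M.adj p.1 p.2) (M.perm p.1 p.2 j) (M.perm p.1 p.2 k)
    rw [M.edgeVal_adj c hj.symm hk.symm, ← h1] at h2
    simp only [F]
    rw [add_add_add_comm, h2, CharTwo.add_self_eq_zero]
  let e := Equiv.ofBijective _ (twoCells_bijective hM)
  let u : M.NCell 2 → ZMod 2 := fun x => Sum.elim
    (fun f : M.Face => F (Quot.out f) ((Quot.out f).2.succAbove 0))
    (fun p => M.edgeVal c p.1 0 p.2) (e.symm x)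
  have htri : ∀ t j, u (triangleCell hM (t, j)) = M.edgeVal c t 0 j := fun t j => by
    have : e.symm (triangleCell hM (t, j)) = Sum.inr (t, j) :=
      e.symm_apply_apply (Sum.inr (t, j))
    simp only [u, this, Sum.elim_inr]
  have hface : ∀ p j, j ≠ p.2 → u (M.faceCell p) = F p j := by
    intro p j hj
    have h1 : M.faceCell p = M.faceCell (Quot.out (M.face p)) :=
      (M.faceCell_eq_iff _ _).2 (M.face_out _).symm
    have h2 : e.symm (M.faceCell p) = Sum.inl (M.face p) := by
      rw [h1]; exact e.symm_apply_apply (Sum.inl (M.face p))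
    simp only [u, h2, Sum.elim_inl]
    rcases M.eq_out_or_eq_glue_out p with hp | hp
    · rw [← hp]
      exact hF _ _ _ (Fin.succAbove_ne _ _) hj
    · obtain ⟨q, hq⟩ : ∃ q, q = Quot.out (M.face p) := ⟨_, rfl⟩
      rw [← hq] at hp ⊢
      obtain ⟨k, rfl⟩ := (M.perm q.1 q.2).surjective j
      have hk : k ≠ q.2 := fun h => hj (by rw [h, hp]; rfl)
      rw [hF q _ k (Fin.succAbove_ne _ _) hk, hp]
      simp only [F, glue]
      rw [M.adj_adj, M.perm_adj, Equiv.Perm.inv_def, Equiv.symm_apply_apply, add_comm]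
  refine ⟨u, fun p j hj => ?_, htri⟩
  rw [sideSum, hface p j hj, htri, htri, add_assoc]
  exact CharTwo.add_self_eq_zero _

variable [Fintype T]

lemma coboundary_tetCell_ideal (φ : M.Cell → ZMod 2) (t : T) :
    M.coboundary φ (M.tetCell t).1 =
      ∑ i, φ (M.faceCell (t, i)).1 + ∑ j, φ (triangleCell hM (t, j)).1 := by
  refine (M.coboundary_cell φ t _).trans ?_
  exact (Finset.sum_congr (by rw [hM]) fun _ _ => rfl).trans (LocalCell.sum_facets_univ_true _)

lemma boundaryMap_two_triangleCell (w : M.NCell 3 → ZMod 2) (p : T × Fin 4) :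
    M.boundaryMap 2 w (triangleCell hM p) = w (M.tetCell p.1) := by
  classical
  have h : ∀ t, M.coboundary (Pi.single (triangleCell hM p).1 1) (M.tetCell t).1 =
      if t = p.1 then 1 else 0 := fun t => by
    rw [coboundary_tetCell_ideal hM, Finset.sum_eq_zero fun i _ =>
      Pi.single_eq_of_ne (faceCell_ne_triangleCell hM _ _) _, zero_add]
    have h1 : ∀ j, (triangleCell hM (t, j)).1 = (triangleCell hM p).1 ↔ t = p.1 ∧ j = p.2 :=
      fun j => M.cell_univ_eq_iff.trans (and_congr_right fun _ => Option.some_inj)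
    simp only [Pi.single_apply, h1]
    by_cases ht : t = p.1 <;> simp [ht]
  rw [boundaryMap_eq_sum, sum_tetCell]
  simp [h]

lemma boundaryMap_two_faceCell_ideal (hM : M.ideal = true) (w : M.NCell 3 → ZMod 2)
    (p : T × Fin 4) :
    M.boundaryMap 2 w (M.faceCell p) = w (M.tetCell p.1) + w (M.tetCell (M.glue p).1) := by
  classical
  have h : ∀ t, M.coboundary (Pi.single (M.faceCell p).1 1) (M.tetCell t).1 =
      ∑ i, if M.face (t, i) = M.face p then 1 else 0 := fun t => by
    rw [coboundary_tetCell_ideal hM, add_comm, Finset.sum_eq_zero fun i _ =>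
      Pi.single_eq_of_ne (faceCell_ne_triangleCell hM _ _).symm _, zero_add]
    refine Finset.sum_congr rfl fun i _ => ?_
    rw [Pi.single_apply]
    exact if_congr (Subtype.ext_iff.symm.trans (M.faceCell_eq_iff (t, i) p)) rfl rfl
  rw [boundaryMap_eq_sum, sum_tetCell]
  simp only [h]
  exact M.sum_mul_sum_face_eq (fun t => w (M.tetCell t)) p

lemma mem_range_of_endSum_eq_zero {u : M.NCell 2 → ZMod 2}
    (hu : ∀ p j, j ≠ p.2 → sideSum hM u p j = 0) (h : endSum hM u = 0) :
    u ∈ LinearMap.range (M.boundaryMap 2) := by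
  have htri : ∀ t j, u (triangleCell hM (t, j)) = u (triangleCell hM (t, 0)) := by
    intro t j
    by_cases hj : j = 0
    · rw [hj]
    · have := endSum_edge hM hu t hj
      rw [h] at this
      exact CharTwo.add_eq_zero.1 this.symm
  let e := Equiv.ofBijective M.tetCell M.tetCell_bijective
  have he : ∀ t, e.symm (M.tetCell t) = t := fun t => e.symm_apply_apply t
  refine ⟨fun x => u (triangleCell hM (e.symm x, 0)), ext_twoCells hM (fun p => ?_) fun p => ?_⟩
  · rw [boundaryMap_two_faceCell_ideal hM, he, he]
    obtain ⟨j, hj⟩ : ∃ j, j ≠ p.2 := exists_ne _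
    have := hu p j hj
    rw [sideSum, htri, htri _ (M.perm _ _ j), add_assoc, CharTwo.add_eq_zero] at this
    exact this.symm
  · rw [boundaryMap_two_triangleCell, he]
    exact (htri p.1 p.2).symm

lemma endSum_boundaryMap (w : M.NCell 3 → ZMod 2) : endSum hM (M.boundaryMap 2 w) = 0 := by
  funext e
  simp only [endSum, LinearMap.coe_mk, AddHom.coe_mk, boundaryMap_two_triangleCell]
  exact CharTwo.add_self_eq_zero _

/-- The equations on the sides of the truncation triangles imply those on the edges if the values
on the triangles come from a cocycle. -/
lemma boundaryMap_one_eq_zero {u : M.NCell 2 → ZMod 2}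
    (hu : ∀ p j, j ≠ p.2 → sideSum hM u p j = 0) : M.boundaryMap 1 u = 0 := by
  classical
  obtain ⟨o, ho, ho'⟩ := M.exists_orientation M.edge_not_reversed
  funext y
  have hpair : ∀ φ : M.Cell → ZMod 2, ∑ y, M.boundaryMap 1 u y * φ y.1 = 0 := by
    intro φ
    rw [sum_boundary_mul_ideal hM]
    let ψ : M.Edge → ZMod 2 := fun e => φ e.1
    let H : T × Fin 4 → ZMod 2 := fun p => ∑ j, ∑ k, if [p.2, j, k].Nodup then
      o p.1 j k * u (triangleCell hM (p.1, j)) * M.edgeVal ψ p.1 j k else 0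
    have hsum : ∀ p, H p + H (M.glue p) =
        u (M.faceCell p) * M.faceApply (fun a b c => ψ a + ψ b + ψ c) p := by
      rintro ⟨t, i⟩
      have h1 : H (M.glue (t, i)) = ∑ j, ∑ k, if [i, j, k].Nodup then
          o t j k * u (triangleCell hM (M.adj t i, M.perm t i j)) * M.edgeVal ψ t j k else 0 := by
        simp only [H, glue]
        rw [← Equiv.sum_comp (M.perm t i)]
        refine Finset.sum_congr rfl fun j _ => ?_
        rw [← Equiv.sum_comp (M.perm t i)]
        refine Finset.sum_congr rfl fun k _ => ?_
        have hn : [M.perm t i i, M.perm t i j, M.perm t i k].Nodup ↔ [i, j, k].Nodup :=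
          List.nodup_map_iff (l := [i, j, k]) (M.perm t i).injective
        by_cases h : [i, j, k].Nodup
        · rw [if_pos h, if_pos (hn.2 h)]
          have hij : i ≠ j := by rintro rfl; simp at h
          have hik : i ≠ k := by rintro rfl; simp at h
          rw [ho' t i j k hij hik, M.edgeVal_adj ψ hij hik]
        · rw [if_neg h, if_neg fun h' => h (hn.1 h')]
      rw [h1]
      simp only [H, ← Finset.sum_add_distrib]
      have h2 : ∀ j k, ((if [i, j, k].Nodup then o t j k * u (triangleCell hM (t, j)) *
          M.edgeVal ψ t j k else 0) + if [i, j, k].Nodup then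
          o t j k * u (triangleCell hM (M.adj t i, M.perm t i j)) * M.edgeVal ψ t j k else 0) =
          if [i, j, k].Nodup then u (M.faceCell (t, i)) * (o t j k * M.edgeVal ψ t j k) else 0 := by
        intro j k
        split_ifs with h
        · have hij : j ≠ i := by rintro rfl; simp at h
          have h3 := hu (t, i) j hij
          rw [sideSum, add_assoc, CharTwo.add_eq_zero] at h3
          rw [h3]
          ring
        · simp
      simp only [h2]
      have key : ∀ j k, j ≠ k → o t j k * M.edgeVal ψ t j k + o t k j * M.edgeVal ψ t k j =
          M.edgeVal ψ t j k := fun j k hjk => by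
        rw [M.edgeVal_symm ψ t k j, ← add_mul, ho t j k hjk, one_mul]
      have hx : ∀ {j k : Fin 4} (h : j ≠ k), ψ (M.edge t j k h) = M.edgeVal ψ t j k :=
        fun h => (M.edgeVal_of_ne ψ t h).symm
      rw [faceApply]
      simp only [hx]
      rw [← key _ _ (i.succAbove_right_injective.ne (by decide : (0 : Fin 3) ≠ 1)),
        ← key _ _ (i.succAbove_right_injective.ne (by decide : (0 : Fin 3) ≠ 2)),
        ← key _ _ (i.succAbove_right_injective.ne (by decide : (1 : Fin 3) ≠ 2))]
      simp only [Fin.sum_univ_four]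
      fin_cases i <;> simp +decide [Fin.succAbove] <;> ring
    have hf : ∀ f : M.Face, (∑ j ∈ {(Quot.out f).2}ᶜ, sideSum hM u (Quot.out f) j *
        φ (M.cell (Quot.out f).1 (some j, {(Quot.out f).2}ᶜ))) = 0 := fun f =>
      Finset.sum_eq_zero fun j hj => by
        rw [hu _ _ (by simpa using hj), zero_mul]
    simp only [hf, add_zero]
    refine (Finset.sum_congr rfl fun f _ => (hsum (Quot.out f)).symm).trans ?_
    refine (M.sum_faces H).symm.trans ?_
    rw [Fintype.sum_prod_type]
    refine Finset.sum_eq_zero fun t _ => ?_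
    simp only [H]
    rw [Finset.sum_comm]
    refine Finset.sum_eq_zero fun j _ => ?_
    rw [Finset.sum_comm]
    refine Finset.sum_eq_zero fun k _ => ?_
    generalize o t j k * u (triangleCell hM (t, j)) * M.edgeVal ψ t j k = a
    revert j k a
    decide
  have h := hpair (Pi.single y.1 1)
  rw [Finset.sum_eq_single y] at h
  · simpa using h
  · intro z _ hz
    rw [Pi.single_eq_of_ne fun h => hz (Subtype.ext h), mul_zero]
  · simp

lemma betti_two_of_ideal (hM : M.ideal = true) : M.betti 2 = Module.finrank (ZMod 2) M.cocycles := by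
  let Ψ := (endSum hM).domRestrict (M.cycles 2)
  have hcyc : ∀ u, u ∈ M.cycles 2 → ∀ p j, j ≠ p.2 → sideSum hM u p j = 0 :=
    fun u hu p j hj => sideSum_eq_zero hM (LinearMap.mem_ker.1 hu) p hj
  have hker : (LinearMap.range (M.boundaryMap 2)).submoduleOf (M.cycles 2) =
      LinearMap.ker Ψ := by
    ext ⟨u, hu⟩
    constructor
    · rintro ⟨w, hw⟩
      rw [LinearMap.mem_ker]
      change endSum hM u = 0
      rw [← show M.boundaryMap 2 w = u from hw, endSum_boundaryMap]
    · intro h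
      exact mem_range_of_endSum_eq_zero hM (hcyc u hu) h
  have hrange : LinearMap.range Ψ = M.cocycles := by
    ext c
    constructor
    · rintro ⟨⟨u, hu⟩, rfl⟩
      exact endSum_mem_cocycles hM (hcyc u hu)
    · intro hc
      obtain ⟨u, hu, hτ⟩ := exists_chain_of_mem_cocycles hM hc
      refine ⟨⟨u, LinearMap.mem_ker.2 (boundaryMap_one_eq_zero hM hu)⟩, funext fun e => ?_⟩
      change endSum hM u e = c e
      obtain ⟨⟨t, j, k⟩, h, rfl⟩ := M.exists_edge_eq e
      dsimp only at h ⊢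
      rw [endSum_edge hM hu, hτ, hτ, ← M.edgeVal_of_ne c t h]
      exact edgeVal_zero_add_edgeVal_zero hc t j k
  rw [betti, ((Submodule.quotEquivOfEq _ _ hker).trans Ψ.quotKerEquivRange).finrank_eq, hrange]

end TriangulatedThreeManifold

namespace TetGluing

variable {T : Type*} (X : TetGluing T)

/-- The `k`-cells of all the vertex links. -/
def allLinkCells (k : ℕ) : Set X.Cell :=
  {x | ∃ t j s, j ∈ s ∧ s.card = k + 2 ∧ x = X.cell t (some j, s)}

/-- The vertex in whose link the given cell lies. -/
def linkVertex : X.Cell → Option X.Cell :=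
  Quot.lift (fun p => p.2.1.bind fun j => if j ∈ p.2.2 then some (X.cell p.1 (none, {j})) else none)
    (by
      rintro ⟨t, v, s⟩ p' ⟨i, hi, rfl⟩
      cases v with
      | none => rfl
      | some j =>
        by_cases hj : j ∈ s
        · have hij : i ≠ j := by rintro rfl; exact hi hj
          have h := X.cell_adj (t := t) (i := i) (none, {j}) (by simpa using hij)
          simp only [LocalCell.map, Option.map_none, Finset.map_singleton,
            Equiv.coe_toEmbedding] at h
          simp [LocalCell.map, hj, h]
        · simp [LocalCell.map, hj])

lemma linkVertex_cell {t : T} {j : Fin 4} {s : Finset (Fin 4)} (hj : j ∈ s) :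
    X.linkVertex (X.cell t (some j, s)) = some (X.cell t (none, {j})) := by
  change (if j ∈ s then some (X.cell t (none, {j})) else none) = _
  rw [if_pos hj]

lemma linkVertex_of_mem {t : T} {j : Fin 4} {k : ℕ} {x : X.Cell} (hx : x ∈ X.linkCells t j k) :
    X.linkVertex x = some (X.cell t (none, {j})) := by
  obtain ⟨t', j', s, hj, -, h, rfl⟩ := hx
  rw [X.linkVertex_cell hj, h]

lemma allLinkCells_two : X.allLinkCells 2 =
    Set.range fun p : T × Fin 4 => X.cell p.1 (some p.2, Finset.univ) := by
  ext x
  constructor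
  · rintro ⟨t, j, s, hj, hs, rfl⟩
    obtain rfl : s = Finset.univ := (Finset.card_eq_iff_eq_univ s).1 (by simpa using hs)
    exact ⟨(t, j), rfl⟩
  · rintro ⟨⟨t, j⟩, rfl⟩
    exact ⟨t, j, Finset.univ, Finset.mem_univ _, by simp, rfl⟩

lemma exists_compl_of_card_eq_three {s : Finset (Fin 4)} (hs : s.card = 3) : ∃ i, s = {i}ᶜ := by
  revert s; decide

lemma allLinkCells_one : X.allLinkCells 1 = Set.range fun p : X.Face × Fin 3 =>
    X.cell (Quot.out p.1).1 (some ((Quot.out p.1).2.succAbove p.2), {(Quot.out p.1).2}ᶜ) := by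
  ext x
  constructor
  · rintro ⟨t, j, s, hj, hs, rfl⟩
    obtain ⟨i, rfl⟩ := exists_compl_of_card_eq_three hs
    rw [Finset.mem_compl, Finset.mem_singleton] at hj
    obtain ⟨q, hq⟩ : ∃ q, q = Quot.out (X.face (t, i)) := ⟨_, rfl⟩
    have hcell : ∃ j', j' ≠ q.2 ∧ X.cell q.1 (some j', {q.2}ᶜ) = X.cell t (some j, {i}ᶜ) := by
      rcases (X.face_eq_iff _ _).1 (X.face_out (X.face (t, i))).symm with h | h
      · have h' : (t, i) = q := hq ▸ h
        subst h'
        exact ⟨j, hj, rfl⟩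
      · have h' : (t, i) = X.glue q := hq ▸ h
        obtain ⟨j', rfl⟩ := (X.perm q.1 q.2).surjective j
        refine ⟨j', ?_, X.cell_compl_eq_iff.2 (.inr ⟨h', rfl⟩)⟩
        rintro rfl
        exact hj (congrArg Prod.snd h').symm
    obtain ⟨j', hj', h⟩ := hcell
    obtain ⟨k, rfl⟩ := Fin.exists_succAbove_eq hj'
    subst hq
    exact ⟨(X.face (t, i), k), h⟩
  · rintro ⟨⟨f, k⟩, rfl⟩
    exact ⟨_, _, _, by simp, by rw [Finset.card_compl]; rfl, rfl⟩

lemma allLinkCells_zero : X.allLinkCells 0 = Set.range fun p : X.Edge × Bool =>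
    X.cell (X.exists_edge_eq p.1).choose.1
      (some (if p.2 then (X.exists_edge_eq p.1).choose.2.1 else (X.exists_edge_eq p.1).choose.2.2),
        {(X.exists_edge_eq p.1).choose.2.1, (X.exists_edge_eq p.1).choose.2.2}) := by
  ext x
  constructor
  · rintro ⟨t, j, s, hj, hs, rfl⟩
    obtain ⟨a, b, hab, rfl⟩ := Finset.card_eq_two.1 hs
    obtain ⟨hne, heq⟩ := (X.exists_edge_eq (X.edge t a b hab)).choose_spec
    obtain ⟨ρ, h1, h2⟩ := X.exists_perm_of_cell_eq (congrArg Subtype.val heq)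
    have hj' : ρ j ∈ ({a, b} : Finset (Fin 4)).map ρ.toEmbedding := by simpa using hj
    rw [← show _ = ({a, b} : Finset (Fin 4)).map ρ.toEmbedding from congrArg Prod.snd h1,
      Finset.mem_insert, Finset.mem_singleton] at hj'
    have h3 := h2 (some j)
    rw [Option.map_some] at h3
    rcases hj' with hj' | hj'
    · refine ⟨(X.edge t a b hab, true), ?_⟩
      rw [hj'] at h3
      exact h3.symm
    · refine ⟨(X.edge t a b hab, false), ?_⟩
      rw [hj'] at h3
      exact h3.symm
  · rintro ⟨⟨e, b⟩, rfl⟩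
    obtain ⟨hne, heq⟩ := (X.exists_edge_eq e).choose_spec
    exact ⟨_, _, _, by cases b <;> simp, Finset.card_pair hne, rfl⟩

variable [Fintype T]

lemma two_mul_card_face : 2 * Fintype.card X.Face = 4 * Fintype.card T := by
  have h := X.sum_faces fun _ => 1
  simp only [Finset.sum_const, Finset.card_univ, Fintype.card_prod, Fintype.card_fin,
    smul_eq_mul] at h
  omega

lemma ncard_allLinkCells_two : (X.allLinkCells 2).ncard = 4 * Fintype.card T := by
  rw [allLinkCells_two, ← Nat.card_coe_set_eq, Nat.card_range_of_injective]
  · simp [mul_comm]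
  · intro p q h
    obtain ⟨h1, h2⟩ := X.cell_univ_eq_iff.1 h
    exact Prod.ext h1 (Option.some_injective _ h2)

lemma ncard_allLinkCells_one : (X.allLinkCells 1).ncard = 3 * Fintype.card X.Face := by
  rw [allLinkCells_one, ← Nat.card_coe_set_eq, Nat.card_range_of_injective]
  · simp [mul_comm]
  · rintro ⟨f, k⟩ ⟨f', k'⟩ h
    rcases X.cell_compl_eq_iff.1 h with ⟨h1, h2⟩ | ⟨h1, h2⟩
    · have h1' : Quot.out f = Quot.out f' := h1
      have h3 : f = f' := by rw [← X.face_out f, h1', X.face_out]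
      subst h3
      obtain rfl : k = k' := Fin.succAbove_right_injective (Option.some_injective _ h2)
      rfl
    · have h1' : Quot.out f' = X.glue (Quot.out f) := h1
      have h3 : f' = f := by rw [← X.face_out f', h1', X.face_glue, X.face_out]
      subst h3
      exact absurd h1'.symm (X.glue_ne _)

lemma ncard_allLinkCells_zero (hX : X.EdgesNotReversed) :
    (X.allLinkCells 0).ncard = 2 * Fintype.card X.Edge := by
  rw [allLinkCells_zero, ← Nat.card_coe_set_eq, Nat.card_range_of_injective]
  · simp [mul_comm]
  · rintro ⟨e, b⟩ ⟨e', b'⟩ h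
    have h1 : e = e' := by
      have h2 := X.cell_none_eq_of_cell_eq h
      obtain ⟨hne, heq⟩ := (X.exists_edge_eq e).choose_spec
      obtain ⟨hne', heq'⟩ := (X.exists_edge_eq e').choose_spec
      rw [heq, heq']
      exact Subtype.ext h2
    subst h1
    obtain ⟨hne, heq⟩ := (X.exists_edge_eq e).choose_spec
    have h3 := hX (X.exists_edge_eq e).choose.1 _ _ hne
    cases b <;> cases b'
    · rfl
    · exact absurd h.symm h3
    · exact absurd h h3
    · rfl

lemma sum_ncard_linkCells [Fintype X.Vertex] (r : X.Vertex → T × Fin 4)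
    (hr : ∀ v, v.1 = X.cell (r v).1 (none, {(r v).2})) (k : ℕ) :
    ∑ v, (X.linkCells (r v).1 (r v).2 k).ncard = (X.allLinkCells k).ncard := by
  simp only [← Nat.card_coe_set_eq]
  rw [← Nat.card_sigma]
  refine Nat.card_congr (Equiv.ofBijective (fun x => ⟨x.2.1, ?_⟩) ⟨?_, ?_⟩)
  · obtain ⟨t, j, s, hj, hs, -, h⟩ := x.2.2
    exact ⟨t, j, s, hj, hs, h⟩
  · rintro ⟨v, x, hx⟩ ⟨v', x', hx'⟩ h
    obtain rfl : x = x' := congrArg Subtype.val h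
    have h1 := (X.linkVertex_of_mem hx).symm.trans (X.linkVertex_of_mem hx')
    rw [Option.some_inj, ← hr, ← hr] at h1
    obtain rfl := Subtype.ext h1
    rfl
  · rintro ⟨x, t, j, s, hj, hs, rfl⟩
    let v : X.Vertex := ⟨X.cell t (none, {j}), t, j, rfl⟩
    exact ⟨⟨v, X.cell t (some j, s), t, j, s, hj, hs, hr v, rfl⟩, rfl⟩

/-- The Euler characteristic computation for a gluing whose vertex links are spheres. -/
lemma card_vertex_add_card (hX : X.EdgesNotReversed) (hlink : ∀ t j, X.linkEulerChar t j = 2) :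
    Nat.card X.Vertex + Fintype.card T = Fintype.card X.Edge := by
  have : Fintype X.Vertex := Fintype.ofFinite _
  have hex : ∀ v : X.Vertex, ∃ p : T × Fin 4, v.1 = X.cell p.1 (none, {p.2}) := by
    rintro ⟨x, t, j, rfl⟩
    exact ⟨(t, j), rfl⟩
  choose r hr using hex
  have h : ∑ v : X.Vertex, X.linkEulerChar (r v).1 (r v).2 = 2 * Fintype.card X.Vertex := by
    simp [hlink, mul_comm]
  simp only [linkEulerChar, Finset.sum_add_distrib, Finset.sum_sub_distrib, ← Nat.cast_sum,
    X.sum_ncard_linkCells r hr, ncard_allLinkCells_two, ncard_allLinkCells_one,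
    X.ncard_allLinkCells_zero hX] at h
  have hF := X.two_mul_card_face
  rw [Nat.card_eq_fintype_card]
  push_cast at h
  omega

end TetGluing

namespace TetGluing

variable {T : Type*} (X : TetGluing T)

/-- Functions on the tetrahedra that are constant on the connected components. -/
def locallyConstant : Submodule (ZMod 2) (T → ZMod 2) where
  carrier := {σ | ∀ p, σ (X.glue p).1 = σ p.1}
  add_mem' ha hb p := congrArg₂ (· + ·) (ha p) (hb p)
  zero_mem' _ := rfl
  smul_mem' r _ ha p := congrArg (r * ·) (ha p)

end TetGluing

namespace TriangulatedThreeManifold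

open TetGluing

variable {T : Type*} {M : TriangulatedThreeManifold T} (hM : M.ideal = false)

/-! ### Closed manifolds -/

lemma isCell_closed (hM : M.ideal = false) (s : Finset (Fin 4)) (hs : s.Nonempty) :
    LocalCell.IsCell M.ideal (none, s) := by
  rw [hM]; exact ⟨rfl, hs⟩

/-- The cell of dimension zero that is the given vertex of a tetrahedron. -/
def vertexCell (p : T × Fin 4) : M.NCell 0 :=
  ⟨M.cell p.1 (none, {p.2}), p.1, _, isCell_closed hM _ (Finset.singleton_nonempty _), by
    simp [LocalCell.dim], rfl⟩

lemma dim_edge {j k : Fin 4} (h : j ≠ k) : LocalCell.dim (none, {j, k}) = 1 := by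
  simp [LocalCell.dim, Finset.card_pair h]

/-- The cell of dimension one that is the given edge. -/
def edgeNCell (e : M.Edge) : M.NCell 1 :=
  ⟨e.1, by
    obtain ⟨t, j, k, h, he⟩ := e.2
    exact ⟨t, _, isCell_closed hM _ (Finset.insert_nonempty _ _), dim_edge h, he⟩⟩

lemma edgeNCell_bijective : Function.Bijective (edgeNCell hM) := by
  refine ⟨fun e e' h => Subtype.ext (congrArg Subtype.val h :), ?_⟩
  rintro ⟨x, t, ⟨v, s⟩, h, hd, rfl⟩
  rw [hM] at h
  obtain ⟨rfl, hs⟩ : v = none ∧ s.Nonempty := h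
  have hs2 : s.card = 2 := by
    simp only [LocalCell.dim, if_true] at hd
    omega
  obtain ⟨j, k, hjk, rfl⟩ := Finset.card_eq_two.1 hs2
  exact ⟨M.edge t j k hjk, rfl⟩

lemma exists_vertexCell_eq (x : M.NCell 0) : ∃ p, x = vertexCell hM p := by
  obtain ⟨x, t, ⟨v, s⟩, h, hd, rfl⟩ := x
  have h' := h
  rw [hM] at h'
  obtain ⟨rfl, hs⟩ : v = none ∧ s.Nonempty := h'
  have hs1 : s.card = 1 := by
    have := hs.card_pos
    simp only [LocalCell.dim, if_true] at hd
    omega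
  obtain ⟨j, rfl⟩ := Finset.card_eq_one.1 hs1
  exact ⟨(t, j), rfl⟩

/-- The cell of dimension zero that is the given vertex. -/
def vertexNCell (v : M.Vertex) : M.NCell 0 :=
  ⟨v.1, by
    obtain ⟨t, j, hv⟩ := v.2
    exact hv ▸ (vertexCell hM (t, j)).2⟩

lemma vertexNCell_bijective : Function.Bijective (vertexNCell hM) := by
  refine ⟨fun v v' h => Subtype.ext (congrArg Subtype.val h :), fun x => ?_⟩
  obtain ⟨⟨t, j⟩, rfl⟩ := exists_vertexCell_eq hM x
  exact ⟨⟨M.cell t (none, {j}), t, j, rfl⟩, rfl⟩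

lemma exists_faceCell_eq (hM : M.ideal = false) (x : M.NCell 2) : ∃ p, x = M.faceCell p := by
  obtain ⟨x, t, ⟨v, s⟩, h, hd, rfl⟩ := x
  have h' := h
  rw [hM] at h'
  obtain ⟨rfl, hs⟩ : v = none ∧ s.Nonempty := h'
  have hs3 : s.card = 3 := by
    simp only [LocalCell.dim, if_true] at hd
    omega
  obtain ⟨i, rfl⟩ := exists_compl_of_card_eq_three hs3
  exact ⟨(t, i), rfl⟩

lemma face_bijective (hM : M.ideal = false) : Function.Bijective fun f : M.Face => M.faceCell (Quot.out f) := by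
  refine ⟨fun f f' h => ?_, fun x => ?_⟩
  · have := (M.faceCell_eq_iff _ _).1 h
    rwa [M.face_out, M.face_out] at this
  · obtain ⟨p, rfl⟩ := exists_faceCell_eq hM x
    exact ⟨M.face p, (M.faceCell_eq_iff _ _).2 (M.face_out _)⟩

lemma vertexCell_glue (t : T) {i j : Fin 4} (h : i ≠ j) :
    vertexCell hM (M.adj t i, M.perm t i j) = vertexCell hM (t, j) := by
  refine Subtype.ext ?_
  have := M.cell_adj (t := t) (i := i) (none, {j}) (by simpa using h)
  simp only [LocalCell.map, Option.map_none, Finset.map_singleton,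
    Equiv.coe_toEmbedding] at this
  exact this

variable [Fintype T]

lemma coboundary_tetCell (hM : M.ideal = false) (φ : M.Cell → ZMod 2) (t : T) :
    M.coboundary φ (M.tetCell t).1 = ∑ i, φ (M.faceCell (t, i)).1 := by
  refine (M.coboundary_cell φ t _).trans ?_
  exact (Finset.sum_congr (by rw [hM]) fun _ _ => rfl).trans (LocalCell.sum_facets_univ_false _)

lemma coboundary_faceCell (hM : M.ideal = false) (φ : M.Cell → ZMod 2) (p : T × Fin 4) :
    M.coboundary φ (M.faceCell p).1 =
      M.faceApply (fun a b c => φ a.1 + φ b.1 + φ c.1) p := by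
  refine (M.coboundary_cell φ p.1 _).trans ?_
  exact (Finset.sum_congr (by rw [hM]) fun _ _ => rfl).trans
    (LocalCell.sum_facets_face_false p.2 _)

lemma coboundary_edge (hM : M.ideal = false) (φ : M.Cell → ZMod 2) (t : T) {j k : Fin 4} (h : j ≠ k) :
    M.coboundary φ (M.edge t j k h).1 = φ (M.cell t (none, {j})) + φ (M.cell t (none, {k})) := by
  refine (M.coboundary_cell φ t _).trans ?_
  exact (Finset.sum_congr (by rw [hM]) fun _ _ => rfl).trans (LocalCell.sum_facets_edge h _)

lemma coboundary_coboundary_tetCell (hM : M.ideal = false) (φ : M.Cell → ZMod 2) (t : T) :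
    M.coboundary (M.coboundary φ) (M.tetCell t).1 = 0 := by
  rw [coboundary_tetCell hM]
  simp only [coboundary_faceCell hM]
  let ψ : M.Edge → ZMod 2 := fun e => φ e.1
  have hx : ∀ {j k : Fin 4} (h : j ≠ k), φ (M.edge t j k h).1 = M.edgeVal ψ t j k :=
    fun h => (M.edgeVal_of_ne ψ t h).symm
  simp only [faceApply, hx, Fin.sum_univ_four]
  have key : ∀ a b c d e f : ZMod 2,
      (c + e + d) + (b + f + d) + (a + f + e) + (a + b + c) = 0 := by
    decide
  exact key (M.edgeVal ψ t 0 1) (M.edgeVal ψ t 0 2) (M.edgeVal ψ t 1 2) (M.edgeVal ψ t 2 3)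
    (M.edgeVal ψ t 1 3) (M.edgeVal ψ t 0 3)

lemma boundaryMap_boundaryMap (hM : M.ideal = false) (w : M.NCell 3 → ZMod 2) :
    M.boundaryMap 1 (M.boundaryMap 2 w) = 0 := by
  funext y
  rw [boundaryMap_eq_sum, sum_boundaryMap_mul, sum_tetCell]
  exact Finset.sum_eq_zero fun t _ => by rw [coboundary_coboundary_tetCell hM, mul_zero]

lemma boundaryMap_two_faceCell (hM : M.ideal = false) (w : M.NCell 3 → ZMod 2) (p : T × Fin 4) :
    M.boundaryMap 2 w (M.faceCell p) = w (M.tetCell p.1) + w (M.tetCell (M.glue p).1) := by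
  classical
  have h : ∀ t, M.coboundary (Pi.single (M.faceCell p).1 1) (M.tetCell t).1 =
      ∑ i, if M.face (t, i) = M.face p then 1 else 0 := fun t => by
    rw [coboundary_tetCell hM]
    refine Finset.sum_congr rfl fun i _ => ?_
    rw [Pi.single_apply]
    exact if_congr (Subtype.ext_iff.symm.trans (M.faceCell_eq_iff (t, i) p)) rfl rfl
  rw [boundaryMap_eq_sum, sum_tetCell]
  simp only [h]
  exact M.sum_mul_sum_face_eq (fun t => w (M.tetCell t)) p

lemma finrank_ker_boundaryMap_two (hM : M.ideal = false) :
    Module.finrank (ZMod 2) (LinearMap.ker (M.boundaryMap 2)) =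
      Module.finrank (ZMod 2) M.locallyConstant := by
  let e := LinearEquiv.funCongrLeft (ZMod 2) (ZMod 2) (Equiv.ofBijective _ M.tetCell_bijective)
  have h : LinearMap.ker (M.boundaryMap 2) = M.locallyConstant.comap e.toLinearMap := by
    ext w
    refine LinearMap.mem_ker.trans ⟨fun hw p => ?_, fun hw => funext fun x => ?_⟩
    · have := (boundaryMap_two_faceCell hM w p).symm.trans (congrFun hw _)
      exact (CharTwo.add_eq_zero.1 this).symm
    · obtain ⟨p, rfl⟩ := exists_faceCell_eq hM x
      rw [boundaryMap_two_faceCell hM]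
      exact CharTwo.add_eq_zero.2 (hw p).symm
  rw [h, Submodule.comap_equiv_eq_map_symm, LinearEquiv.finrank_map_eq]

lemma finrank_ker_coboundaryMap_one (hM : M.ideal = false) :
    Module.finrank (ZMod 2) (LinearMap.ker (M.coboundaryMap 1)) =
      Module.finrank (ZMod 2) M.cocycles := by
  let e := LinearEquiv.funCongrLeft (ZMod 2) (ZMod 2) (Equiv.ofBijective _ (edgeNCell_bijective hM))
  have h : LinearMap.ker (M.coboundaryMap 1) = M.cocycles.comap e.toLinearMap := by
    ext φ
    obtain ⟨ψ, rfl⟩ := M.exists_extension φ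
    refine LinearMap.mem_ker.trans ⟨fun hw p => ?_, fun hw => funext fun x => ?_⟩
    · exact (coboundary_faceCell hM ψ p).symm.trans
        ((M.coboundaryMap_apply ψ _).symm.trans (congrFun hw (M.faceCell p)))
    · obtain ⟨p, rfl⟩ := exists_faceCell_eq hM x
      rw [coboundaryMap_apply, coboundary_faceCell hM]
      exact hw p
  rw [h, Submodule.comap_equiv_eq_map_symm, LinearEquiv.finrank_map_eq]

lemma mem_ker_coboundaryMap_zero_iff (φ : M.NCell 0 → ZMod 2) :
    φ ∈ LinearMap.ker (M.coboundaryMap 0) ↔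
      ∀ t j, φ (vertexCell hM (t, j)) = φ (vertexCell hM (t, 0)) := by
  obtain ⟨ψ, rfl⟩ := M.exists_extension φ
  refine LinearMap.mem_ker.trans ⟨fun h t j => ?_, fun h => funext fun x => ?_⟩
  · by_cases hj : j = 0
    · rw [hj]
    · have h1 := (M.coboundaryMap_apply ψ _).symm.trans (congrFun h (edgeNCell hM (M.edge t j 0 hj)))
      exact CharTwo.add_eq_zero.1 ((coboundary_edge hM ψ t hj).symm.trans h1)
  · obtain ⟨e, rfl⟩ := (edgeNCell_bijective hM).2 x
    obtain ⟨⟨t, j, k⟩, hjk, rfl⟩ := M.exists_edge_eq e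
    refine (M.coboundaryMap_apply ψ _).trans ?_
    refine (coboundary_edge hM ψ t hjk).trans (CharTwo.add_eq_zero.2 ?_)
    exact (h t j).trans (h t k).symm

lemma finrank_ker_coboundaryMap_zero (hM : M.ideal = false) :
    Module.finrank (ZMod 2) (LinearMap.ker (M.coboundaryMap 0)) =
      Module.finrank (ZMod 2) M.locallyConstant := by
  let D : (M.NCell 0 → ZMod 2) →ₗ[ZMod 2] (T → ZMod 2) :=
    LinearMap.funLeft (ZMod 2) (ZMod 2) fun t => vertexCell hM (t, 0)
  let Ψ := D.domRestrict (LinearMap.ker (M.coboundaryMap 0))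
  have hinj : Function.Injective Ψ := by
    rintro ⟨φ, hφ⟩ ⟨φ', hφ'⟩ h
    rw [mem_ker_coboundaryMap_zero_iff hM] at hφ hφ'
    refine Subtype.ext (funext fun x => ?_)
    obtain ⟨⟨t, j⟩, rfl⟩ := exists_vertexCell_eq hM x
    exact (hφ t j).trans ((congrFun h t).trans (hφ' t j).symm)
  have hrange : LinearMap.range Ψ = M.locallyConstant := by
    ext σ
    constructor
    · rintro ⟨⟨φ, hφ⟩, rfl⟩ ⟨t, i⟩
      rw [mem_ker_coboundaryMap_zero_iff hM] at hφ
      obtain ⟨j, hj⟩ : ∃ j, j ≠ i := exists_ne _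
      change φ (vertexCell hM (M.adj t i, 0)) = φ (vertexCell hM (t, 0))
      rw [← hφ _ (M.perm t i j), vertexCell_glue hM t hj.symm, hφ]
    · intro hσ
      let ψ : M.Cell → ZMod 2 := Quot.lift (fun p => σ p.1) (by
        rintro ⟨t, x⟩ p' ⟨i, hi, rfl⟩
        exact (hσ (t, i)).symm)
      exact ⟨⟨fun x => ψ x.1, (mem_ker_coboundaryMap_zero_iff hM _).2 fun t j => rfl⟩, rfl⟩
  rw [← hrange, LinearMap.finrank_range_of_inj hinj]

lemma betti_zero_add_finrank_range :
    M.betti 0 + Module.finrank (ZMod 2) (LinearMap.range (M.boundaryMap 0)) =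
      Fintype.card (M.NCell 0) := by
  have hle : LinearMap.range (M.boundaryMap 0) ≤ M.cycles 0 := le_top (α := Submodule _ _)
  have h := Submodule.finrank_quotient_add_finrank
    ((LinearMap.range (M.boundaryMap 0)).submoduleOf (M.cycles 0))
  rw [(Submodule.submoduleOfEquivOfLe hle).finrank_eq] at h
  refine h.trans ?_
  rw [← Module.finrank_fintype_fun_eq_card (ZMod 2)]
  exact finrank_top _ _

lemma betti_two_add_finrank_range (hM : M.ideal = false) :
    M.betti 2 + Module.finrank (ZMod 2) (LinearMap.range (M.boundaryMap 2)) =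
      Module.finrank (ZMod 2) (LinearMap.ker (M.boundaryMap 1)) := by
  have h := Submodule.finrank_quotient_add_finrank
    ((LinearMap.range (M.boundaryMap 2)).submoduleOf (M.cycles 2))
  have hle : LinearMap.range (M.boundaryMap 2) ≤ M.cycles 2 := by
    rintro _ ⟨w, rfl⟩
    exact LinearMap.mem_ker.2 (boundaryMap_boundaryMap hM w)
  rwa [(Submodule.submoduleOfEquivOfLe hle).finrank_eq] at h

lemma betti_two_add_card_vertex (hM : M.ideal = false) :
    M.betti 2 + Nat.card M.Vertex = Module.finrank (ZMod 2) M.cocycles + M.betti 0 := by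
  have h0 := M.finrank_range_add_finrank_ker 0
  have h1 := M.finrank_range_add_finrank_ker 1
  have h1' := (M.boundaryMap 1).finrank_range_add_finrank_ker
  have h2' := (M.boundaryMap 2).finrank_range_add_finrank_ker
  rw [Module.finrank_fintype_fun_eq_card] at h1' h2'
  have hb0 := M.betti_zero_add_finrank_range
  have hb2 := betti_two_add_finrank_range hM
  have hE : Fintype.card (M.NCell 1) = Fintype.card M.Edge :=
    (Fintype.card_of_bijective (edgeNCell_bijective hM)).symm
  have hF : Fintype.card (M.NCell (1 + 1)) = Fintype.card M.Face :=
    (Fintype.card_of_bijective (face_bijective hM)).symm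
  have hT : Fintype.card (M.NCell (2 + 1)) = Fintype.card T :=
    (Fintype.card_of_bijective M.tetCell_bijective).symm
  have hV : Fintype.card (M.NCell 0) = Nat.card M.Vertex := by
    rw [← Nat.card_eq_fintype_card]
    exact (Nat.card_eq_of_bijective _ (vertexNCell_bijective hM)).symm
  have hχ := M.card_vertex_add_card M.edge_not_reversed (M.link_sphere hM)
  have h2F := M.two_mul_card_face
  rw [finrank_ker_coboundaryMap_zero hM] at h0
  rw [finrank_ker_coboundaryMap_one hM] at h1
  rw [finrank_ker_boundaryMap_two hM] at h2'
  omega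

end TriangulatedThreeManifold

namespace TriangulatedThreeManifold

open TetGluing

variable {T : Type*} [Fintype T] (M : TriangulatedThreeManifold T)

lemma turaevViro_three_of_not_hasBoundary (h : ¬ M.HasBoundary) :
    M.turaevViro 3 (Complex.exp (Real.pi * Complex.I / 3)) =
      (2 : ℂ) ^ ((M.betti 2 : ℤ) - (M.betti 0 : ℤ)) := by
  rw [turaevViro_three]
  congr 1
  cases hM : M.ideal with
  | false =>
    have h1 := betti_two_add_card_vertex hM
    have h2 : M.numVertices = Nat.card M.Vertex := if_neg (by simp [hM])
    omega
  | true =>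
    have hT : IsEmpty T := not_nonempty_iff.1 fun hT => h ⟨hM, hT⟩
    have hN : IsEmpty (M.NCell 0) := ⟨fun x => by
      obtain ⟨t, -⟩ := x.2
      exact hT.elim t⟩
    have h0 := M.betti_zero_add_finrank_range
    rw [Fintype.card_eq_zero] at h0
    have h2 : M.numVertices = 0 := if_pos hM
    have h3 := betti_two_of_ideal hM
    omega

lemma turaevViro_three_of_hasBoundary (h : M.HasBoundary) :
    M.turaevViro 3 (Complex.exp (Real.pi * Complex.I / 3)) = (2 : ℂ) ^ M.betti 2 := by
  have h2 : M.numVertices = 0 := if_pos h.1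
  rw [turaevViro_three, betti_two_of_ideal h.1, h2, Nat.cast_zero, sub_zero, zpow_natCast]

end TriangulatedThreeManifold

end

theorem mainTheorem5 {T : Type*} [Fintype T] (M : TriangulatedThreeManifold T) :
    (∀ r : ℕ, 3 ≤ r → Odd r → ∀ A A₃ : ℂ,
      (IsPrimitiveRoot A (2 * r) ∧ IsPrimitiveRoot A₃ (2 * 3)) ∨
        (IsPrimitiveRoot A (4 * r) ∧ IsPrimitiveRoot A₃ (4 * 3)) →
      M.turaevViro r A = M.turaevViro 3 A₃ * M.turaevViroSO3 r A) ∧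
    (¬ M.HasBoundary →
      M.turaevViro 3 (Complex.exp (Real.pi * Complex.I / 3)) =
        (2 : ℂ) ^ ((M.betti 2 : ℤ) - (M.betti 0 : ℤ))) ∧
    (M.IsConnected → M.HasBoundary →
      M.turaevViro 3 (Complex.exp (Real.pi * Complex.I / 3)) = (2 : ℂ) ^ M.betti 2) ∧
    M.turaevViro 3 (Complex.exp (Real.pi * Complex.I / 3)) ≠ 0 := by
  refine ⟨?_, M.turaevViro_three_of_not_hasBoundary, fun _ => M.turaevViro_three_of_hasBoundary, ?_⟩
  · rintro r hr hodd A A₃ (⟨hA, hA₃⟩ | ⟨hA, hA₃⟩)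
    · exact M.turaevViro_eq_mul (QuantumNumber.isReflecting_two_mul hodd (by omega) hA)
        (QuantumNumber.isReflecting_two_mul (by decide) (by omega) hA₃) hr hodd
    · exact M.turaevViro_eq_mul (QuantumNumber.isReflecting_four_mul (by omega) hA)
        (QuantumNumber.isReflecting_four_mul (by omega) hA₃) hr hodd
  · rw [M.turaevViro_three]
    exact zpow_ne_zero _ two_ne_zero
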